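/- **Setting.** Let $d\ge 1$, $L>0$, and let $\mathcal F_L$ be the class of functions $f:[0,1]^d\to[0,1]$ with $|f(x)-f(y)|\le L\|x-y\|_\infty$. For a probability distribution $\mathcal D$ on $[0,1]^d\times[0,1]$ with marginal $\mathcal D_x$ on $[0,1]^d$ put $\mathrm{err}_{\mathcal D}(f)=\mathbb E_{(x,y)\sim\mathcal D}|y-f(x)|$ and $\mathrm{err}_{\mathcal D}(\mathcal F_L)=\min_{f\in\mathcal F_L}\mathrm{err}_{\mathcal D}(f)$. **Algorithm** $\mathrm{Error}(L,\mathcal D,\eta)$, with sizes $M,N,K\in\mathbb N$. *Preprocessing.* Independently for each axis $j$ draw $b^j_1$ uniformly from $\{0,1,\dots,\lfloor d/(2\eta)\rfloor\}\cdot\frac2L$, and divide $[0,1]$ along axis $j$ into the long interval $[0,b^j_1]$, followed by alternating short intervals of length $2/L$ and long intervals of length $d/(L\eta)$, all cut off at $1$. A long box is a product of long intervals. Draw a pool $S$ of $M$ i.i.d. unlabeled points from $\mathcal D_x$; each has a hidden label, drawn from the conditional distribution given the point, which is revealed on request. In each long box only the first $K$ pool points are kept. *Query$(x)$.* If $x$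 lies in a long box $B$, ask for the labels of the kept pool points in $B$ and output $\hat f(x)$, where $\hat f\in\mathcal F_L$ minimizes the empirical error $\sum|y_i-f(x_i)|$ over these points. Otherwise, if $x$ lies in the extension $\hat B$ of a long box $B$ ($B$ with a shell of thickness $1/L$ added, cut off at the boundary of $[0,1]^d$), ask for the same labels and output $g(x)$, where $g:\hat B\to[0,1]$ is an $L$-Lipschitz extension of $\hat f|_B$ that equals $1$ at the points of $\hat B$ having some coordinate at distance exactly $1/L$ beyond an end of the corresponding side of $B$. Otherwise output $1$. Ties (between minimizers, and between extensions) are broken by an arbitrary measurable rule depending on the box and the labeled points in it. *Output.* Draw $N$ i.i.d. labeled examples $(x_t,y_t)\sim\mathcal D$, independent of everything else, and output $\widehat{\mathrm{err}}=\frac1N\sum_{t=1}^N|\mathrm{Query}(x_t)-y_t|$. **Theorem.** For every $\varepsilon_0<1$ there are constants $c\in(0,1]$ and $C>0$ such that for all $d\ge1$, $0<\varepsilon\le\varepsilon_0$ and $L\ge\varepsilon$ there are sizes $M,N,K$, not depending on $\mathcal D$, with $$M+N\le\frac1{\varepsilon^3}\Big(\frac{CL}{\varepsilon}\Big)^d\log\frac1\varepsilon,\qquad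 N\le\frac{C}{\varepsilon^2},$$ for which the following holds. Measurable tie-breaking rules exist, and for each of them $\mathrm{Error}(L,\mathcal D,c\,\varepsilon)$ always asks for at most $$\frac1{\varepsilon^4}\Big(\frac{Cd}{\varepsilon^2}\Big)^d\log\frac1\varepsilon$$ labels (those of the $N$ labeled examples included), and for every probability distribution $\mathcal D$ on $[0,1]^d\times[0,1]$, with probability at least $\frac12$, $$\big|\widehat{\mathrm{err}}-\mathrm{err}_{\mathcal D}(\mathcal F_L)\big|\le\varepsilon .$$ -/

import Mathlib

open MeasureTheory

namespace LocalLip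

/-- The domain `[0,1]^d`; its distance is the sup-norm distance. -/
abbrev Cube (d : ℕ) : Type := Fin d → unitInterval

/-- The class `F_L` of functions `[0,1]^d → [0,1]` that are `L`-Lipschitz for the sup norm. -/
def lipClass (d : ℕ) (L : ℝ) : Set (Cube d → unitInterval) :=
  {f | ∀ x y, |(f x : ℝ) - f y| ≤ L * dist x y}

/-- The prediction error `E_{(x,y) ∼ D} |y - f x|`. -/
noncomputable def err {d : ℕ} (D : Measure (Cube d × unitInterval))
    (f : Cube d → unitInterval) : ℝ :=
  ∫ p, |(p.2 : ℝ) - f p.1| ∂D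

/-- The optimal prediction error of the class `F_L`. -/
noncomputable def optErr {d : ℕ} (D : Measure (Cube d × unitInterval)) (L : ℝ) : ℝ :=
  ⨅ f : lipClass d L, err D (f : Cube d → unitInterval)

/-- The empirical error (a sum) on a finite list of labeled points. -/
noncomputable def empErr {d : ℕ} (s : List (Cube d × unitInterval))
    (f : Cube d → unitInterval) : ℝ :=
  (s.map fun p => |(p.2 : ℝ) - f p.1|).sum

/-! Programs that may ask for labels. -/

/-- A computation with access to a label oracle: it stops with a value, or asks for the
label of one data point and continues depending on the answer. -/
inductive LabelProg (ι α : Type) : Type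
  | done (a : α) : LabelProg ι α
  | ask (i : ι) (next : unitInterval → LabelProg ι α) : LabelProg ι α

namespace LabelProg

variable {ι α β : Type}

/-- Sequential composition. -/
def bind : LabelProg ι α → (α → LabelProg ι β) → LabelProg ι β
  | done a, k => k a
  | ask i next, k => ask i fun y => (next y).bind k

/-- The output of the program when the labels are given by `label`. -/
def output (label : ι → unitInterval) : LabelProg ι α → α
  | done a => a
  | ask i next => (next (label i)).output label

/-- The number of label queries made when the labels are given by `label`. -/
def numQueries (label : ι → unitInterval) : LabelProg ι α → ℕ
  | done _ => 0
  | ask i next => (next (label i)).numQueries label + 1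

/-- Ask for the labels of all data points in a list. -/
def askAll : List ι → LabelProg ι (List unitInterval)
  | [] => done []
  | i :: l => ask i fun y => (askAll l).bind fun ys => done (y :: ys)

end LabelProg

/-! The random partition. -/

/-- A partition of every coordinate axis of `[0,1]^d` into alternating long intervals of length
`d / (L η)` and short intervals of length `2 / L`. The first interval along axis `i` is the long
interval `[0, offset i]`; all intervals are cut off at `1`. -/
structure Grid (d : ℕ) where
  L : ℝ
  η : ℝ
  offset : Fin d → ℝ

namespace Grid

variable {d : ℕ} (G : Grid d)

/-- The length of one long interval followed by one short interval. -/
noncomputable def period : ℝ := d / (G.L * G.η) + 2 / G.L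

/-- Left end of the `k`-th long interval along axis `i`. -/
noncomputable def left (i : Fin d) : ℕ → ℝ
  | 0 => 0
  | k + 1 => G.offset i + 2 / G.L + k * G.period

/-- Right end of the `k`-th long interval along axis `i` (before the cut-off at `1`). -/
noncomputable def right (i : Fin d) (k : ℕ) : ℝ := G.offset i + k * G.period

/-- The lower and the upper corner of the long box with index `J`. -/
noncomputable def lower (J : Fin d → ℕ) : Fin d → ℝ := fun i => G.left i (J i)

noncomputable def upper (J : Fin d → ℕ) : Fin d → ℝ := fun i => G.right i (J i)

/-- `J` is the index of a long box of the partition of `[0,1]^d`. -/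
def IsIndex (J : Fin d → ℕ) : Prop := ∀ i, G.lower J i < 1

end Grid

/-- The box with corners `lo` and `hi`, cut off at the boundary of `[0,1]^d`. -/
def box {d : ℕ} (lo hi : Fin d → ℝ) : Set (Cube d) :=
  {x | ∀ i, lo i ≤ x i ∧ (x i : ℝ) ≤ hi i}

/-- The extension box: the box with a shell of thickness `1 / L` around it, cut off at the
boundary of `[0,1]^d`. -/
def extBox {d : ℕ} (L : ℝ) (lo hi : Fin d → ℝ) : Set (Cube d) :=
  box (fun i => lo i - 1 / L) (fun i => hi i + 1 / L)

/-- A rule that maps a box (given by its corners) and a list of labeled points in it to a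
prediction function; only its values on the extension box will be used. -/
abbrev BoxRule (d : ℕ) : Type :=
  (lo hi : Fin d → ℝ) → List (Cube d × unitInterval) → Cube d → unitInterval

/-- On the box the rule is an empirical risk minimizer over `F_L` for the given labeled points;
on the extension box it is an `L`-Lipschitz extension of it which takes the value `1` on the
outer faces of the shell, that is, on the points of the extension box with some coordinate in the
middle of a neighbouring short interval (these have length `2 / L`). Ties between minimizers and
between extensions are broken arbitrarily, but measurably. -/
structure IsERMRule {d : ℕ} (L : ℝ) (A : BoxRule d) : Prop where
  erm : ∀ lo hi s, ∃ f ∈ lipClass d L, (∀ g ∈ lipClass d L, empErr s f ≤ empErr s g) ∧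
    ∀ x ∈ box lo hi, A lo hi s x = f x
  lipschitz : ∀ lo hi s, ∀ x ∈ extBox L lo hi, ∀ y ∈ extBox L lo hi,
    |(A lo hi s x : ℝ) - A lo hi s y| ≤ L * dist x y
  eq_one : ∀ lo hi s, ∀ x ∈ extBox L lo hi,
    (∃ i, (x i : ℝ) = lo i - 1 / L ∨ (x i : ℝ) = hi i + 1 / L) → A lo hi s x = 1
  measurable : ∀ lo hi x (n : ℕ),
    Measurable fun s : Fin n → Cube d × unitInterval => A lo hi (List.ofFn s) x

/-! The algorithms. In all of them `pool : Fin M → Cube d` is the pool `S` of unlabeled points,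
and `cap` is the number of pool points that are kept in a long box (later ones are discarded). -/

open Classical in
/-- The long box that is used to answer the query `x`: the long box that contains `x`, or
else a long box whose extension contains `x`, if there is one. -/
noncomputable def locate {d : ℕ} (G : Grid d) (x : Cube d) : Option (Fin d → ℕ) :=
  if h : ∃ J, G.IsIndex J ∧ x ∈ box (G.lower J) (G.upper J) then some h.choose
  else if h : ∃ J, G.IsIndex J ∧ x ∈ extBox G.L (G.lower J) (G.upper J) then some h.choose
  else none

open Classical in
/-- The first `cap` points of the pool that lie in the long box with index `J`. -/
noncomputable def poolIn {d M : ℕ} (G : Grid d) (cap : ℕ) (pool : Fin M → Cube d)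
    (J : Fin d → ℕ) : List (Fin M) :=
  ((List.finRange M).filter fun m => pool m ∈ box (G.lower J) (G.upper J)).take cap

/-- The local query algorithm: ask for the labels of the pool points in the relevant long
box, and evaluate the rule at `x`; output `1` if there is no relevant box. The labels are
those of the pool points (`Sum.inl`) and of the `N` test points (`Sum.inr`). -/
noncomputable def queryAlg {d M N : ℕ} (A : BoxRule d) (G : Grid d) (cap : ℕ)
    (pool : Fin M → Cube d) (x : Cube d) : LabelProg (Fin M ⊕ Fin N) unitInterval :=
  match locate G x with
  | none => .done 1
  | some J =>
    (LabelProg.askAll ((poolIn G cap pool J).map Sum.inl)).bind fun ys =>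
      .done (A (G.lower J) (G.upper J) (((poolIn G cap pool J).map pool).zip ys) x)

/-- The sum of the losses `|Query(x_t) - y_t|` over a list of test points. -/
noncomputable def lossSum {d M N : ℕ} (A : BoxRule d) (G : Grid d) (cap : ℕ)
    (pool : Fin M → Cube d) (test : Fin N → Cube d) :
    List (Fin N) → LabelProg (Fin M ⊕ Fin N) ℝ
  | [] => .done 0
  | t :: l =>
    (queryAlg A G cap pool (test t)).bind fun v =>
      .ask (Sum.inr t) fun y =>
        (lossSum A G cap pool test l).bind fun r => .done (|(v : ℝ) - y| + r)

/-- The error estimation algorithm: the average loss of the local query algorithm over the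
`N` test points. -/
noncomputable def errorAlg {d M N : ℕ} (A : BoxRule d) (G : Grid d) (cap : ℕ)
    (pool : Fin M → Cube d) (test : Fin N → Cube d) : LabelProg (Fin M ⊕ Fin N) ℝ :=
  (lossSum A G cap pool test (List.finRange N)).bind fun r => .done (r / N)

/-- The largest offset, in units of `2 / L`. -/
noncomputable def maxOffset (d : ℕ) (η : ℝ) : ℕ := ⌊(d : ℝ) / (2 * η)⌋₊

/-- The random choices: an offset for every axis, the pool and the test points, the last two
with their labels, which the algorithm only sees by asking. -/
abbrev Outcome (d M N : ℕ) (η : ℝ) : Type :=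
  (Fin d → Fin (maxOffset d η + 1)) ×
    (Fin M → Cube d × unitInterval) × (Fin N → Cube d × unitInterval)

/-- Uniform independent offsets, and independent samples from `D`. -/
noncomputable def outcomeLaw {d : ℕ} (M N : ℕ) (η : ℝ) (D : Measure (Cube d × unitInterval)) :
    Measure (Outcome d M N η) :=
  (PMF.uniformOfFintype (Fin d → Fin (maxOffset d η + 1))).toMeasure.prod
    ((Measure.pi fun _ => D).prod (Measure.pi fun _ => D))

namespace Outcome

variable {d M N : ℕ} {η : ℝ}

/-- The partition with boundary at the random offsets. -/
noncomputable def grid (L : ℝ) (ω : Outcome d M N η) : Grid d where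
  L := L
  η := η
  offset := fun i => (ω.1 i : ℕ) * (2 / L)

/-- The labels of the pool points and of the test points. -/
def label (ω : Outcome d M N η) : Fin M ⊕ Fin N → unitInterval :=
  Sum.elim (fun m => (ω.2.1 m).2) (fun t => (ω.2.2 t).2)

/-- The error estimation algorithm on the outcome `ω` of the random choices. -/
noncomputable def run (L : ℝ) (A : BoxRule d) (cap : ℕ) (ω : Outcome d M N η) :
    LabelProg (Fin M ⊕ Fin N) ℝ :=
  errorAlg A (grid L ω) cap (fun m => (ω.2.1 m).1) (fun t => (ω.2.2 t).1)

/-- The estimate that the algorithm outputs. -/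
noncomputable def estimate (L : ℝ) (A : BoxRule d) (cap : ℕ) (ω : Outcome d M N η) : ℝ :=
  (run L A cap ω).output (label ω)

/-- The number of labels that the algorithm asks for, those of the test points included. -/
noncomputable def numLabels (L : ℝ) (A : BoxRule d) (cap : ℕ) (ω : Outcome d M N η) : ℕ :=
  (run L A cap ω).numQueries (label ω)

end Outcome

end LocalLip

/-! For a fixed grid and pool, all answers are values of one function, `query`, and by `estimate_eq`
the output is the mean loss of that function on the test points. The value `1` on the outer faces
glues the local predictions into a member of `lipClass` (`query_mem_lipClass`). Hence its error is
never below `optErr`. The deviation of the estimate is therefore at most a test-sample fluctuation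
plus the excess of `query` over `optErr`, which is compared with a nearly optimal competitor `f`.

The excess is bounded in expectation. Outside the long boxes it is at most the mass there, and this
averages to at most `2 * η` over the offsets, because on each axis at most one offset puts a given
coordinate into a short interval (`lintegral_outside_le`). In a long box that received `K` pool
points, a finite net of the Lipschitz class and Hoeffding's inequality (`exists_net`,
`measure_kept_sum_ge_le`) show that the empirical minimizer loses at most `7 * δ` times the mass of
the box, up to a small failure probability. A box with fewer than `K` pool points costs at most `K /
M` on average, whatever its mass (`lintegral_length_kept_lt_le`). The masses sum to at most one, so
only the term `K / M` is multiplied by the number of boxes. With all contributions below `ε / 2` in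
total, Markov's inequality gives probability one half.

The sizes come from `K` being of order `log (1 / ε) / ε ^ 2` times the number of net points in a
box. That number is at most `(C d / ε ^ 2) ^ d`, and its product with the number of boxes is at most
`(C L / ε) ^ d`.

A measurable rule exists because the minimizers form a compact lattice: the largest one depends
upper semicontinuously on the sample, and so does its McShane extension (`isERMRule_mcShaneRule`).
-/

namespace LocalLip

/-! ### Label programs: output and number of queries. -/

namespace LabelProg

variable {ι α β : Type}

lemma output_bind (label : ι → unitInterval) (p : LabelProg ι α) (k : α → LabelProg ι β) :
    (p.bind k).output label = (k (p.output label)).output label := by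
  induction p with
  | done a => rfl
  | ask i next ih => exact ih _

lemma numQueries_bind (label : ι → unitInterval) (p : LabelProg ι α) (k : α → LabelProg ι β) :
    (p.bind k).numQueries label =
      p.numQueries label + (k (p.output label)).numQueries label := by
  induction p with
  | done a => simp [bind, numQueries, output]
  | ask i next ih =>
    have := ih (label i)
    simp only [bind, numQueries, output, this]
    ring

lemma output_askAll (label : ι → unitInterval) (l : List ι) :
    (askAll l).output label = l.map label := by
  induction l with
  | nil => rfl
  | cons i l ih => simp [askAll, output, output_bind, ih]

lemma numQueries_askAll (label : ι → unitInterval) (l : List ι) :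
    (askAll l).numQueries label = l.length := by
  induction l with
  | nil => rfl
  | cons i l ih => simp [askAll, numQueries, numQueries_bind, ih]

end LabelProg

variable {d M N : ℕ}

open Classical in
/-- The first `K` labeled points of a list that lie in `B`. -/
noncomputable def kept (B : Set (Cube d)) (K : ℕ) (s : List (Cube d × unitInterval)) :
    List (Cube d × unitInterval) :=
  (s.filter fun z => z.1 ∈ B).take K

/-- The answer to the query `x` for the labeled pool `P`. -/
noncomputable def query (A : BoxRule d) (G : Grid d) (cap : ℕ)
    (P : Fin M → Cube d × unitInterval) (x : Cube d) : unitInterval :=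
  match locate G x with
  | none => 1
  | some J => A (G.lower J) (G.upper J) (kept (box (G.lower J) (G.upper J)) cap (List.ofFn P)) x

open Classical in
lemma kept_eq_map_poolIn (G : Grid d) (cap : ℕ) (P : Fin M → Cube d × unitInterval)
    (J : Fin d → ℕ) :
    kept (box (G.lower J) (G.upper J)) cap (List.ofFn P) =
      (poolIn G cap (fun m => (P m).1) J).map P := by
  simp only [kept, poolIn, List.map_take, List.ofFn_eq_map, List.filter_map]
  rfl

lemma output_queryAlg (A : BoxRule d) (G : Grid d) (cap : ℕ)
    (P : Fin M → Cube d × unitInterval) (label : Fin M ⊕ Fin N → unitInterval)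
    (hlabel : ∀ m, label (Sum.inl m) = (P m).2) (x : Cube d) :
    (queryAlg A G cap (fun m => (P m).1) x).output label = query A G cap P x := by
  unfold queryAlg query
  cases locate G x with
  | none => rfl
  | some J =>
    simp only [LabelProg.output_bind, LabelProg.output_askAll, LabelProg.output,
      kept_eq_map_poolIn, List.map_map]
    congr 1
    rw [show label ∘ Sum.inl = fun m => (P m).2 from funext hlabel, List.zip_map']

lemma numQueries_queryAlg_le (A : BoxRule d) (G : Grid d) (cap : ℕ) (pool : Fin M → Cube d)
    (label : Fin M ⊕ Fin N → unitInterval) (x : Cube d) :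
    (queryAlg A G cap pool x).numQueries label ≤ cap := by
  unfold queryAlg
  cases locate G x with
  | none => exact Nat.zero_le _
  | some J =>
    simp only [LabelProg.numQueries_bind, LabelProg.numQueries_askAll, LabelProg.numQueries,
      List.length_map, add_zero, poolIn]
    exact List.length_take_le _ _

lemma output_lossSum (A : BoxRule d) (G : Grid d) (cap : ℕ)
    (P : Fin M → Cube d × unitInterval) (test : Fin N → Cube d × unitInterval)
    (l : List (Fin N)) :
    (lossSum A G cap (fun m => (P m).1) (fun t => (test t).1) l).output
        (Sum.elim (fun m => (P m).2) fun t => (test t).2) =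
      (l.map fun t => |(query A G cap P (test t).1 : ℝ) - (test t).2|).sum := by
  induction l with
  | nil => rfl
  | cons t l ih =>
    simp only [lossSum, LabelProg.output_bind, LabelProg.output, ih, List.map_cons, List.sum_cons,
      Sum.elim_inr]
    rw [output_queryAlg A G cap P _ (fun _ => rfl)]

lemma numQueries_lossSum_le (A : BoxRule d) (G : Grid d) (cap : ℕ) (pool : Fin M → Cube d)
    (test : Fin N → Cube d) (label : Fin M ⊕ Fin N → unitInterval) (l : List (Fin N)) :
    (lossSum A G cap pool test l).numQueries label ≤ l.length * (cap + 1) := by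
  induction l with
  | nil => simp [lossSum, LabelProg.numQueries]
  | cons t l ih =>
    have h := numQueries_queryAlg_le (N := N) A G cap pool label (test t)
    simp only [lossSum, LabelProg.numQueries_bind, LabelProg.numQueries, List.length_cons]
    linarith

/-- The grid with the given multiples of `2 / L` as offsets. -/
noncomputable def offsetGrid (L η : ℝ) {n : ℕ} (o : Fin d → Fin n) : Grid d where
  L := L
  η := η
  offset := fun i => (o i : ℕ) * (2 / L)

lemma estimate_eq {η : ℝ} (L : ℝ) (A : BoxRule d) (cap : ℕ) (ω : Outcome d M N η) :
    ω.estimate L A cap =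
      (∑ t, |(query A (offsetGrid L η ω.1) cap ω.2.1 (ω.2.2 t).1 : ℝ) - (ω.2.2 t).2|) / N := by
  have h := output_lossSum A (offsetGrid L η ω.1) cap ω.2.1 ω.2.2 (List.finRange N)
  rw [← List.ofFn_eq_map, List.sum_ofFn] at h
  rw [← h]
  unfold Outcome.estimate Outcome.run errorAlg
  rw [LabelProg.output_bind]
  rfl

lemma numLabels_le {η : ℝ} (L : ℝ) (A : BoxRule d) (cap : ℕ) (ω : Outcome d M N η) :
    ω.numLabels L A cap ≤ N * (cap + 1) := by
  have h := numQueries_lossSum_le A (ω.grid L) cap (fun m => (ω.2.1 m).1)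
    (fun t => (ω.2.2 t).1) ω.label (List.finRange N)
  rw [List.length_finRange] at h
  unfold Outcome.numLabels Outcome.run errorAlg
  rw [LabelProg.numQueries_bind]
  exact h

end LocalLip

/-! ### Geometry of the boxes and the global Lipschitz property of the query function. -/

namespace LocalLip

variable {d M N : ℕ}

/-- The coordinatewise projection of the cube to the box with corners `lo` and `hi`. -/
noncomputable def clamp (lo hi : Fin d → ℝ) (y : Cube d) : Cube d := fun i =>
  Set.projIcc 0 1 zero_le_one (max (lo i) (min (y i) (hi i)))

lemma dist_clamp_le (lo hi : Fin d → ℝ) (x y : Cube d) :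
    dist (clamp lo hi x) (clamp lo hi y) ≤ dist x y := by
  refine (dist_pi_le_iff dist_nonneg).2 fun i => ?_
  refine le_trans ?_ (dist_le_pi_dist x y i)
  have h := (LipschitzWith.projIcc (zero_le_one' ℝ)).dist_le_mul
    (max (lo i) (min (x i : ℝ) (hi i))) (max (lo i) (min (y i : ℝ) (hi i)))
  rw [NNReal.coe_one, one_mul] at h
  refine h.trans ?_
  rw [Subtype.dist_eq, Real.dist_eq, Real.dist_eq]
  calc _ ≤ _ := abs_max_sub_max_le_max _ _ _ _
    _ ≤ |min (x i : ℝ) (hi i) - min (y i : ℝ) (hi i)| := by simp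
    _ ≤ _ := abs_min_sub_min_le_max _ _ _ _
    _ ≤ _ := by simp

lemma coe_clamp {lo hi : Fin d → ℝ} {x : Cube d} (hx : x ∈ box lo hi) (y : Cube d) (i : Fin d) :
    (clamp lo hi y i : ℝ) = max (lo i) (min (y i) (hi i)) := by
  have h1 := hx i
  have h2 := (x i).2
  have h3 := (y i).2
  unfold clamp
  rw [Set.projIcc_of_mem]
  constructor
  · exact le_max_of_le_right (le_min h3.1 (h2.1.trans h1.2))
  · exact max_le (h1.1.trans h2.2) ((min_le_left _ _).trans h3.2)

lemma clamp_mem_box {lo hi : Fin d → ℝ} {x : Cube d} (hx : x ∈ box lo hi) (y : Cube d) :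
    clamp lo hi y ∈ box lo hi := fun i => by
  rw [coe_clamp hx]
  exact ⟨le_max_left _ _, max_le ((hx i).1.trans (hx i).2) (min_le_right _ _)⟩

lemma clamp_of_mem_box {lo hi : Fin d → ℝ} {x : Cube d} (hx : x ∈ box lo hi) :
    clamp lo hi x = x := by
  ext i
  rw [coe_clamp hx, min_eq_left (hx i).2, max_eq_right (hx i).1]

lemma exists_clamp_eq_of_notMem_box {lo hi : Fin d → ℝ} {x y : Cube d} (hx : x ∈ box lo hi)
    (hy : y ∉ box lo hi) :
    ∃ i, (clamp lo hi y i : ℝ) = lo i ∨ (clamp lo hi y i : ℝ) = hi i := by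
  simp only [box, Set.mem_ofPred_eq, not_forall, not_and_or, not_le] at hy
  obtain ⟨i, hi'⟩ := hy
  refine ⟨i, ?_⟩
  rw [coe_clamp hx]
  rcases hi' with h | h
  · left
    exact max_eq_left ((min_le_left _ _).trans h.le)
  · right
    rw [min_eq_right h.le, max_eq_right ((hx i).1.trans (hx i).2)]

lemma measurableSet_box (lo hi : Fin d → ℝ) : MeasurableSet (box lo hi) := by
  have : box lo hi = ⋂ i, {x : Cube d | lo i ≤ x i ∧ (x i : ℝ) ≤ hi i} := by
    ext x
    simp [box]
  rw [this]
  refine MeasurableSet.iInter fun i => ?_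
  have hm : Measurable fun x : Cube d => (x i : ℝ) :=
    measurable_subtype_coe.comp (measurable_pi_apply i)
  exact (measurableSet_le measurable_const hm).inter (measurableSet_le hm measurable_const)

lemma box_subset_extBox {L : ℝ} (hL : 0 < L) (lo hi : Fin d → ℝ) :
    box lo hi ⊆ extBox L lo hi := fun x hx i => by
  have h := hx i
  have : 0 < 1 / L := by positivity
  constructor <;> linarith

/-- Projecting `y` to the extension box is 1-Lipschitz, fixes `x`, and lands on an outer face, where
the rule is `1`; the Lipschitz bound inside the extension box then applies. -/
lemma IsERMRule.one_sub_le {L : ℝ} {A : BoxRule d} (hA : IsERMRule L A) (hL : 0 < L)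
    {lo hi : Fin d → ℝ} {s : List (Cube d × unitInterval)} {x y : Cube d}
    (hx : x ∈ extBox L lo hi) (hy : y ∉ extBox L lo hi) :
    1 - (A lo hi s x : ℝ) ≤ L * dist x y := by
  set z := clamp (fun i => lo i - 1 / L) (fun i => hi i + 1 / L) y with hz
  have hzE : z ∈ extBox L lo hi := clamp_mem_box hx y
  have h1 : A lo hi s z = 1 := hA.eq_one lo hi s z hzE (exists_clamp_eq_of_notMem_box hx hy)
  have h2 := hA.lipschitz lo hi s z hzE x hx
  rw [h1, Set.Icc.coe_one] at h2
  refine ((le_abs_self _).trans h2).trans (mul_le_mul_of_nonneg_left ?_ hL.le)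
  rw [dist_comm]
  have := dist_clamp_le (fun i => lo i - 1 / L) (fun i => hi i + 1 / L) x y
  rwa [clamp_of_mem_box hx] at this

namespace Grid

variable {G : Grid d}

/-- The grid parameters are positive and the offsets nonnegative. -/
structure Proper (G : Grid d) : Prop where
  L_pos : 0 < G.L
  η_pos : 0 < G.η
  offset_nonneg : ∀ i, 0 ≤ G.offset i

lemma Proper.long_nonneg (hG : G.Proper) : 0 ≤ (d : ℝ) / (G.L * G.η) := by
  have := hG.L_pos
  have := hG.η_pos
  positivity

lemma Proper.period_pos (hG : G.Proper) : 0 < G.period := by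
  have := hG.L_pos
  have := hG.long_nonneg
  unfold period
  positivity

lemma Proper.left_nonneg (hG : G.Proper) (i : Fin d) (k : ℕ) : 0 ≤ G.left i k := by
  have := hG.L_pos
  have := hG.period_pos
  have := hG.offset_nonneg i
  cases k with
  | zero => exact le_rfl
  | succ k =>
    simp only [left]
    positivity

lemma Proper.right_add_le_left (hG : G.Proper) (i : Fin d) {k l : ℕ} (h : k < l) :
    G.right i k + 2 / G.L ≤ G.left i l := by
  obtain ⟨n, rfl⟩ := Nat.exists_eq_add_of_lt h
  have := mul_nonneg (Nat.cast_nonneg (α := ℝ) n) hG.period_pos.le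
  simp only [left, right]
  push_cast
  linarith

/-- Different long intervals are at least `2 / L` apart, while the shell is only `1 / L` thick. -/
lemma Proper.index_unique (hG : G.Proper) {J J' : Fin d → ℕ} {x : Cube d}
    (h : x ∈ box (G.lower J) (G.upper J)) (h' : x ∈ extBox G.L (G.lower J') (G.upper J')) :
    J = J' := by
  have hL : 0 < 1 / G.L := one_div_pos.2 hG.L_pos
  have h2 : 2 / G.L = 1 / G.L + 1 / G.L := by ring
  funext i
  have hi := h i
  have hi' := h' i
  simp only [lower, upper] at hi hi'
  rcases lt_trichotomy (J i) (J' i) with hlt | heq | hlt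
  · have := hG.right_add_le_left i hlt
    linarith
  · exact heq
  · have := hG.right_add_le_left i hlt
    linarith

/-- Two shells of thickness `1 / L` across a gap of at least `2 / L` can touch only at their outer
ends, where every rule has the value `1`. -/
lemma Proper.mem_face (hG : G.Proper) {J J' : Fin d → ℕ} (hJ : J ≠ J') {x : Cube d}
    (h : x ∈ extBox G.L (G.lower J) (G.upper J)) (h' : x ∈ extBox G.L (G.lower J') (G.upper J')) :
    ∃ i, (x i : ℝ) = G.lower J i - 1 / G.L ∨ (x i : ℝ) = G.upper J i + 1 / G.L := by
  have h2 : 2 / G.L = 1 / G.L + 1 / G.L := by ring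
  obtain ⟨i, hne⟩ := Function.ne_iff.1 hJ
  refine ⟨i, ?_⟩
  have hi := h i
  have hi' := h' i
  simp only [lower, upper] at hi hi' ⊢
  rcases lt_or_gt_of_ne hne with hlt | hlt
  · have := hG.right_add_le_left i hlt
    right
    linarith
  · have := hG.right_add_le_left i hlt
    left
    linarith

end Grid

section Query

variable {G : Grid d} {A : BoxRule d}

/-- The choices made in `locate` do not matter: a long box is determined by any of its points, and
where two extensions meet both rules give `1`. -/
lemma query_of_mem_extBox (hG : G.Proper) (hA : IsERMRule G.L A) (cap : ℕ)
    (P : Fin M → Cube d × unitInterval) {J : Fin d → ℕ} (hJ : G.IsIndex J) {x : Cube d}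
    (hx : x ∈ extBox G.L (G.lower J) (G.upper J)) :
    query A G cap P x =
      A (G.lower J) (G.upper J) (kept (box (G.lower J) (G.upper J)) cap (List.ofFn P)) x := by
  unfold query locate
  by_cases h : ∃ J, G.IsIndex J ∧ x ∈ box (G.lower J) (G.upper J)
  · rw [dif_pos h, ← hG.index_unique h.choose_spec.2 hx]
  · have h' : ∃ J, G.IsIndex J ∧ x ∈ extBox G.L (G.lower J) (G.upper J) := ⟨J, hJ, hx⟩
    rw [dif_neg h, dif_pos h']
    have hc := h'.choose_spec.2
    by_cases he : h'.choose = J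
    · rw [he]
    · rw [hA.eq_one _ _ _ x hx (hG.mem_face (Ne.symm he) hx hc)]
      exact hA.eq_one _ _ _ x hc (hG.mem_face he hc hx)

lemma query_of_forall_notMem (hG : G.Proper) (cap : ℕ) (P : Fin M → Cube d × unitInterval)
    {x : Cube d} (hx : ∀ J, G.IsIndex J → x ∉ extBox G.L (G.lower J) (G.upper J)) :
    query A G cap P x = 1 := by
  unfold query locate
  rw [dif_neg, dif_neg]
  · rintro ⟨J, hJ, h⟩
    exact hx J hJ h
  · rintro ⟨J, hJ, h⟩
    exact hx J hJ (box_subset_extBox hG.L_pos _ _ h)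

lemma one_sub_query_le (hG : G.Proper) (hA : IsERMRule G.L A) (cap : ℕ)
    (P : Fin M → Cube d × unitInterval) {x y : Cube d}
    (h : ∀ J, G.IsIndex J → x ∈ extBox G.L (G.lower J) (G.upper J) →
      y ∉ extBox G.L (G.lower J) (G.upper J)) :
    1 - (query A G cap P x : ℝ) ≤ G.L * dist x y := by
  by_cases hx : ∃ J, G.IsIndex J ∧ x ∈ extBox G.L (G.lower J) (G.upper J)
  · obtain ⟨J, hJ, hxJ⟩ := hx
    rw [query_of_mem_extBox hG hA cap P hJ hxJ]
    exact hA.one_sub_le hG.L_pos hxJ (h J hJ hxJ)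
  · push Not at hx
    rw [query_of_forall_notMem hG cap P hx]
    have := mul_nonneg hG.L_pos.le (dist_nonneg (x := x) (y := y))
    simpa using this

/-- Two points in a common extension are covered by the local rule. Otherwise both values lie within
`L * dist x y` below `1`, hence that close to each other. -/
lemma query_mem_lipClass (hG : G.Proper) (hA : IsERMRule G.L A) (cap : ℕ)
    (P : Fin M → Cube d × unitInterval) : query A G cap P ∈ lipClass d G.L := by
  intro x y
  by_cases h : ∃ J, G.IsIndex J ∧ x ∈ extBox G.L (G.lower J) (G.upper J) ∧
      y ∈ extBox G.L (G.lower J) (G.upper J)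
  · obtain ⟨J, hJ, hx, hy⟩ := h
    rw [query_of_mem_extBox hG hA cap P hJ hx, query_of_mem_extBox hG hA cap P hJ hy]
    exact hA.lipschitz _ _ _ x hx y hy
  · push Not at h
    have h1 := one_sub_query_le hG hA cap P h
    have h2 := one_sub_query_le hG hA cap P (x := y) (y := x)
      fun J hJ hy hx => h J hJ hx hy
    rw [dist_comm] at h2
    have h3 := (query A G cap P x).2.2
    have h4 := (query A G cap P y).2.2
    rw [abs_sub_le_iff]
    constructor <;> linarith

end Query

/-! ### Measurability of the rule and of the query function in the pool. -/

open Classical in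
-- The list of kept indices takes countably many values and depends only on finitely many membership
-- bits; once it is fixed, the kept points are a tuple of fixed length.
lemma measurable_kept_comp {W β : Type*} [MeasurableSpace W] [MeasurableSpace β]
    (Φ : List (Cube d × unitInterval) → W → β)
    (hΦ : ∀ n, Measurable fun p : (Fin n → Cube d × unitInterval) × W => Φ (List.ofFn p.1) p.2)
    {B : Set (Cube d)} (hB : MeasurableSet B) (K : ℕ) :
    Measurable fun p : (Fin M → Cube d × unitInterval) × W =>
      Φ (kept B K (List.ofFn p.1)) p.2 := by
  let _ : MeasurableSpace (List (Fin M)) := ⊤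
  have : MeasurableSingletonClass (List (Fin M)) := ⟨fun _ => trivial⟩
  let F : (Fin M → Bool) → List (Fin M) := fun b => ((List.finRange M).filter b).take K
  have h1 : Measurable fun p : (Fin M → Cube d × unitInterval) × W =>
      F fun m => if (p.1 m).1 ∈ B then true else false := by
    refine (measurable_of_countable F).comp (measurable_pi_iff.2 fun m => ?_)
    refine Measurable.ite ?_ measurable_const measurable_const
    exact (measurable_fst.comp ((measurable_pi_apply m).comp measurable_fst)) hB
  have h2 : Measurable fun q : List (Fin M) × ((Fin M → Cube d × unitInterval) × W) =>
      Φ (q.1.map q.2.1) q.2.2 := by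
    refine measurable_from_prod_countable_right fun l => ?_
    have h3 : ∀ P : Fin M → Cube d × unitInterval,
        l.map P = List.ofFn fun i : Fin l.length => P (l.get i) := fun P => by
      rw [show (fun i : Fin l.length => P (l.get i)) = P ∘ l.get from rfl, ← List.map_ofFn,
        List.ofFn_get]
    simp only [h3]
    refine (hΦ l.length).comp (Measurable.prodMk ?_ measurable_snd)
    exact measurable_pi_iff.2 fun i => (measurable_pi_apply _).comp measurable_fst
  convert! h2.comp (h1.prodMk measurable_id) using 2 with p
  simp only [Function.comp, F, kept, List.ofFn_eq_map, List.filter_map, List.map_take, id]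
  have h4 : ((fun z : Cube d × unitInterval => decide (z.1 ∈ B)) ∘ p.1) =
      fun m => if (p.1 m).1 ∈ B then true else false := by
    funext m
    by_cases h : (p.1 m).1 ∈ B <;> simp [h]
  rw [h4]

lemma lipClass_continuous {L : ℝ} (hL : 0 ≤ L) {f : Cube d → unitInterval}
    (hf : f ∈ lipClass d L) : Continuous f := by
  have : LipschitzWith ⟨L, hL⟩ f := LipschitzWith.of_dist_le_mul fun x y => by
    rw [Subtype.dist_eq, Real.dist_eq]
    exact hf x y
  exact this.continuous

/-- A Carathéodory argument: continuity in the query point and measurability in the sample give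
joint measurability. -/
lemma measurable_rule {L : ℝ} (hL : 0 ≤ L) {A : BoxRule d} (hA : IsERMRule L A)
    (lo hi : Fin d → ℝ) {B : Set (Cube d)} (hB : MeasurableSet B) (K : ℕ) :
    Measurable fun p : (Fin M → Cube d × unitInterval) × extBox L lo hi =>
      A lo hi (kept B K (List.ofFn p.1)) p.2 := by
  refine measurable_kept_comp (fun s (x : extBox L lo hi) => A lo hi s x) (fun n => ?_) hB K
  refine (measurable_uncurry_of_continuous_of_measurable
    (u := fun (x : extBox L lo hi) (s : Fin n → Cube d × unitInterval) =>
      A lo hi (List.ofFn s) x) (fun s => ?_) fun x => hA.measurable lo hi x n).comp measurable_swap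
  have : LipschitzWith ⟨L, hL⟩ fun x : extBox L lo hi => A lo hi (List.ofFn s) x :=
    LipschitzWith.of_dist_le_mul fun x y => by
      rw [Subtype.dist_eq, Real.dist_eq]
      exact hA.lipschitz lo hi _ x x.2 y y.2
  exact this.continuous

lemma measurable_query {G : Grid d} {A : BoxRule d} (hG : G.Proper) (hA : IsERMRule G.L A)
    (cap : ℕ) : Measurable fun p : (Fin M → Cube d × unitInterval) × Cube d =>
      query A G cap p.1 p.2 := by
  let E : (Fin d → ℕ) → Set ((Fin M → Cube d × unitInterval) × Cube d) := fun J =>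
    Prod.snd ⁻¹' extBox G.L (G.lower J) (G.upper J)
  have hE : ∀ J, MeasurableSet (E J) := fun J => measurable_snd (measurableSet_box _ _)
  let O : Set ((Fin M → Cube d × unitInterval) × Cube d) := ⋂ J, ⋂ _ : G.IsIndex J, (E J)ᶜ
  have hO : MeasurableSet O :=
    MeasurableSet.iInter fun J => MeasurableSet.iInter fun _ => (hE J).compl
  intro S hS
  have key : (fun p : (Fin M → Cube d × unitInterval) × Cube d => query A G cap p.1 p.2) ⁻¹' S =
      (⋃ J, ⋃ _ : G.IsIndex J, Prod.map id Subtype.val ''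
        ((fun p : (Fin M → Cube d × unitInterval) × extBox G.L (G.lower J) (G.upper J) =>
          A (G.lower J) (G.upper J)
            (kept (box (G.lower J) (G.upper J)) cap (List.ofFn p.1)) p.2) ⁻¹' S)) ∪
      {p | p ∈ O ∧ (1 : unitInterval) ∈ S} := by
    ext ⟨P, x⟩
    simp only [Set.mem_preimage, Set.mem_union, Set.mem_iUnion, Set.mem_image, Prod.exists,
      Prod.map, Prod.mk.injEq, id, Subtype.exists, Set.mem_ofPred_eq]
    constructor
    · intro h
      by_cases hx : ∃ J, G.IsIndex J ∧ x ∈ extBox G.L (G.lower J) (G.upper J)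
      · obtain ⟨J, hJ, hxJ⟩ := hx
        rw [query_of_mem_extBox hG hA cap P hJ hxJ] at h
        exact Or.inl ⟨J, hJ, P, x, hxJ, h, rfl, rfl⟩
      · push Not at hx
        rw [query_of_forall_notMem hG cap P hx] at h
        exact Or.inr ⟨Set.mem_iInter₂.2 hx, h⟩
    · rintro (⟨J, hJ, P', x', hx', h, rfl, rfl⟩ | ⟨hxO, h⟩)
      · rwa [query_of_mem_extBox hG hA cap P' hJ hx']
      · rwa [query_of_forall_notMem hG cap P fun J hJ => Set.mem_iInter₂.1 hxO J hJ]
  rw [key]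
  refine MeasurableSet.union (MeasurableSet.iUnion fun J => MeasurableSet.iUnion fun _ => ?_)
    (hO.inter (MeasurableSet.const _))
  refine MeasurableEmbedding.measurableSet_image' ?_ (measurable_rule hG.L_pos.le hA _ _
    (measurableSet_box _ _) cap hS)
  exact MeasurableEmbedding.id.prodMap (MeasurableEmbedding.subtype_coe (measurableSet_box _ _))

end LocalLip

/-! ### Concentration for the first `K` pool points in a set. -/

namespace LocalLip

open scoped ENNReal

variable {d M N : ℕ}

lemma kept_zero (B : Set (Cube d)) (s : List (Cube d × unitInterval)) : kept B 0 s = [] := rfl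

lemma kept_cons_of_mem {B : Set (Cube d)} {z : Cube d × unitInterval} (hz : z.1 ∈ B) (K : ℕ)
    (s : List (Cube d × unitInterval)) : kept B (K + 1) (z :: s) = z :: kept B K s := by
  simp [kept, hz]

lemma kept_cons_of_notMem {B : Set (Cube d)} {z : Cube d × unitInterval} (hz : z.1 ∉ B) (K : ℕ)
    (s : List (Cube d × unitInterval)) : kept B K (z :: s) = kept B K s := by
  simp [kept, hz]

lemma length_kept_le (B : Set (Cube d)) (K : ℕ) (s : List (Cube d × unitInterval)) :
    (kept B K s).length ≤ K := List.length_take_le _ _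

lemma mem_of_mem_kept {B : Set (Cube d)} {K : ℕ} {s : List (Cube d × unitInterval)}
    {z : Cube d × unitInterval} (hz : z ∈ kept B K s) : z.1 ∈ B := by
  simpa using (List.mem_filter.1 (List.mem_of_mem_take hz)).2

variable {D : Measure (Cube d × unitInterval)} [IsProbabilityMeasure D]

/-- Peels off the first pool point. The inequality, unlike the equality, needs no measurability of
`F`. -/
lemma lintegral_pi_succ_le (F : List (Cube d × unitInterval) → ℝ≥0∞) :
    ∫⁻ P : Fin (M + 1) → Cube d × unitInterval, F (List.ofFn P) ∂Measure.pi (fun _ => D) ≤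
      ∫⁻ z, ∫⁻ P : Fin M → Cube d × unitInterval, F (z :: List.ofFn P)
        ∂Measure.pi (fun _ => D) ∂D := by
  have h := measurePreserving_piFinSuccAbove (fun _ : Fin (M + 1) => D) 0
  have h2 := h.lintegral_comp_emb (MeasurableEquiv.measurableEmbedding _)
    fun q => F (q.1 :: List.ofFn q.2)
  refine le_trans (le_of_eq ?_) (lintegral_prod_le
    fun q : (Cube d × unitInterval) × (Fin M → Cube d × unitInterval) => F (q.1 :: List.ofFn q.2))
  rw [← h2]
  refine lintegral_congr fun P => ?_
  simp only [List.ofFn_succ]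
  rfl

lemma lintegral_kept_succ_le {B : Set (Cube d)} (hB : MeasurableSet B) (K : ℕ)
    (F : List (Cube d × unitInterval) → ℝ≥0∞) :
    ∫⁻ P : Fin (M + 1) → Cube d × unitInterval, F (kept B (K + 1) (List.ofFn P))
        ∂Measure.pi (fun _ => D) ≤
      (∫⁻ z in Prod.fst ⁻¹' B, ∫⁻ P : Fin M → Cube d × unitInterval,
        F (z :: kept B K (List.ofFn P)) ∂Measure.pi (fun _ => D) ∂D) +
      D (Prod.fst ⁻¹' B)ᶜ * ∫⁻ P : Fin M → Cube d × unitInterval,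
        F (kept B (K + 1) (List.ofFn P)) ∂Measure.pi (fun _ => D) := by
  have hS : MeasurableSet (Prod.fst ⁻¹' B : Set (Cube d × unitInterval)) := measurable_fst hB
  refine (lintegral_pi_succ_le fun s => F (kept B (K + 1) s)).trans (le_of_eq ?_)
  rw [← lintegral_add_compl _ hS]
  congr 1
  · refine setLIntegral_congr_fun hS fun z hz => ?_
    refine lintegral_congr fun P => ?_
    rw [kept_cons_of_mem (B := B) hz]
  · rw [mul_comm, ← setLIntegral_const]
    refine setLIntegral_congr_fun hS.compl fun z hz => ?_
    refine lintegral_congr fun P => ?_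
    rw [kept_cons_of_notMem (B := B) hz]

/-- This replaces independence of the kept points. By induction on the pool, a first point in `B`
contributes a factor `a` on average and lowers `K`, and a point outside `B` changes nothing. The
condition `1 ≤ a` covers lists that stay shorter than `K`. -/
lemma lintegral_kept_prod_le {B : Set (Cube d)} (hB : MeasurableSet B)
    {w : Cube d × unitInterval → ℝ≥0∞} (hw : ∀ z, w z ≠ ∞) {a : ℝ≥0∞} (ha : 1 ≤ a)
    (hwa : ∫⁻ z in Prod.fst ⁻¹' B, w z ∂D ≤ a * D (Prod.fst ⁻¹' B)) (M K : ℕ) :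
    ∫⁻ P : Fin M → Cube d × unitInterval, ((kept B K (List.ofFn P)).map w).prod
      ∂Measure.pi (fun _ => D) ≤ a ^ K := by
  have hS : MeasurableSet (Prod.fst ⁻¹' B : Set (Cube d × unitInterval)) := measurable_fst hB
  induction M generalizing K with
  | zero => simpa [kept] using one_le_pow₀ ha
  | succ M ih =>
    cases K with
    | zero => simp [kept_zero]
    | succ K =>
      refine (lintegral_kept_succ_le hB K fun s => (s.map w).prod).trans ?_
      calc _ ≤ (∫⁻ z in Prod.fst ⁻¹' B, w z * a ^ K ∂D) + D (Prod.fst ⁻¹' B)ᶜ * a ^ (K + 1) := by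
            refine add_le_add (lintegral_mono fun z => ?_) (mul_le_mul_right (ih _) _)
            simp only [List.map_cons, List.prod_cons]
            rw [lintegral_const_mul' _ _ (hw z)]
            exact mul_le_mul_right (ih _) _
        _ ≤ a * D (Prod.fst ⁻¹' B) * a ^ K + D (Prod.fst ⁻¹' B)ᶜ * a ^ (K + 1) := by
            refine add_le_add_left ?_ _
            by_cases hfin : a ^ K = ∞
            · have : a = ∞ := by
                by_contra h
                exact ENNReal.pow_ne_top h hfin
              rw [hfin]
              rcases eq_or_ne (D (Prod.fst ⁻¹' B)) 0 with h0 | h0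
              · rw [Measure.restrict_eq_zero.2 h0]
                simp
              · rw [this, ENNReal.top_mul h0, ENNReal.top_mul_top]
                exact le_top
            · rw [lintegral_mul_const' _ _ hfin]
              exact mul_le_mul_left hwa _
        _ = (D (Prod.fst ⁻¹' B) + D (Prod.fst ⁻¹' B)ᶜ) * a ^ (K + 1) := by ring
        _ = a ^ (K + 1) := by rw [measure_add_measure_compl hS, measure_univ, one_mul]

/-- Mass times the probability of a short list is at most `K / M`, so light boxes need no separate
treatment. The induction conditions on whether the first point lies in `B`, and the extra summand
for `M + 1` is bounded by the mass. -/
lemma lintegral_length_kept_lt_le {B : Set (Cube d)} (hB : MeasurableSet B) (M K : ℕ) :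
    M * D (Prod.fst ⁻¹' B) * ∫⁻ P : Fin M → Cube d × unitInterval,
      (if (kept B K (List.ofFn P)).length < K then 1 else 0) ∂Measure.pi (fun _ => D) ≤ K := by
  have hS : MeasurableSet (Prod.fst ⁻¹' B : Set (Cube d × unitInterval)) := measurable_fst hB
  induction M generalizing K with
  | zero => simp
  | succ M ih =>
    cases K with
    | zero => simp
    | succ K =>
      set p := D (Prod.fst ⁻¹' B) with hp
      have hpp : p + D (Prod.fst ⁻¹' B)ᶜ = 1 := by
        rw [hp, measure_add_measure_compl hS, measure_univ]
      set q : ℕ → ℕ → ℝ≥0∞ := fun M K => ∫⁻ P : Fin M → Cube d × unitInterval,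
        (if (kept B K (List.ofFn P)).length < K then 1 else 0) ∂Measure.pi (fun _ => D) with hq
      have hq1 : ∀ M K, q M K ≤ 1 := fun M K => by
        calc q M K ≤ ∫⁻ _ : Fin M → Cube d × unitInterval, 1 ∂Measure.pi (fun _ => D) :=
              lintegral_mono fun P => by split_ifs <;> simp
          _ = 1 := by simp
      have hrec : q (M + 1) (K + 1) ≤ p * q M K + D (Prod.fst ⁻¹' B)ᶜ * q M (K + 1) := by
        refine (lintegral_kept_succ_le hB K fun s => if s.length < K + 1 then 1 else 0).trans
          (le_of_eq ?_)
        simp only [List.length_cons, add_lt_add_iff_right, lintegral_const,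
          MeasurableSet.univ, Measure.restrict_apply, Set.univ_inter]
        rw [mul_comm (lintegral _ _)]
      change ((M + 1 : ℕ) : ℝ≥0∞) * p * q (M + 1) (K + 1) ≤ _
      calc ((M + 1 : ℕ) : ℝ≥0∞) * p * q (M + 1) (K + 1)
          = M * p * q (M + 1) (K + 1) + p * q (M + 1) (K + 1) := by push_cast; ring
        _ ≤ M * p * (p * q M K + D (Prod.fst ⁻¹' B)ᶜ * q M (K + 1)) + p * 1 :=
            add_le_add (mul_le_mul_right hrec _) (mul_le_mul_right (hq1 _ _) _)
        _ = p * (M * p * q M K) + D (Prod.fst ⁻¹' B)ᶜ * (M * p * q M (K + 1)) + p := by ring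
        _ ≤ p * K + D (Prod.fst ⁻¹' B)ᶜ * ((K + 1 : ℕ) : ℝ≥0∞) + p := by
            gcongr
            · exact ih K
            · exact ih (K + 1)
        _ = (p + D (Prod.fst ⁻¹' B)ᶜ) * ((K + 1 : ℕ) : ℝ≥0∞) := by push_cast; ring
        _ = ((K + 1 : ℕ) : ℝ≥0∞) := by rw [hpp, one_mul]

/-- Hoeffding's lemma for the law conditioned on `S`, multiplied by `D S` so that it remains true
for null sets. -/
lemma lintegral_exp_le {S : Set (Cube d × unitInterval)}
    {W : Cube d × unitInterval → ℝ} (hW : Measurable W) (hW1 : ∀ z, |W z| ≤ 1) (t : ℝ) :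
    ∫⁻ z in S, ENNReal.ofReal (Real.exp (t * (W z - (∫ z in S, W z ∂D) / D.real S))) ∂D ≤
      ENNReal.ofReal (Real.exp (t ^ 2 / 2)) * D S := by
  rcases eq_or_ne (D S) 0 with h0 | h0
  · rw [Measure.restrict_eq_zero.2 h0]
    simp
  · have := ProbabilityTheory.cond_isProbabilityMeasure (μ := D) h0
    set ν := ProbabilityTheory.cond D S with hν
    have hmean : ∫ z, W z ∂ν = (∫ z in S, W z ∂D) / D.real S := by
      rw [hν, ProbabilityTheory.cond, integral_smul_measure, ENNReal.toReal_inv, smul_eq_mul,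
        Measure.real]
      ring
    have hsub := ProbabilityTheory.hasSubgaussianMGF_of_mem_Icc (μ := ν) (X := W) (a := -1)
      (b := 1) hW.aemeasurable (Filter.Eventually.of_forall fun z => abs_le.1 (hW1 z))
    have h1 := hsub.mgf_le t
    rw [hmean] at h1
    have h2 : (((‖(1 : ℝ) - -1‖₊ / 2) ^ 2 : NNReal) : ℝ) = 1 := by
      norm_num
    rw [h2, one_mul] at h1
    have hD : D.restrict S = D S • ν := by
      rw [hν, ProbabilityTheory.cond, smul_smul, ENNReal.mul_inv_cancel h0 (measure_ne_top D S),
        one_smul]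
    rw [hD, lintegral_smul_measure, smul_eq_mul, mul_comm]
    refine mul_le_mul_left ?_ _
    rw [← hD, ← ofReal_integral_eq_lintegral_ofReal]
    · exact ENNReal.ofReal_le_ofReal h1
    · have := hsub.integrable_exp_mul t
      rwa [hmean] at this
    · exact Filter.Eventually.of_forall fun z => (Real.exp_pos _).le

lemma measurable_kept_sum {W : Cube d × unitInterval → ℝ} (hW : Measurable W)
    {B : Set (Cube d)} (hB : MeasurableSet B) (K : ℕ) :
    Measurable fun P : Fin M → Cube d × unitInterval =>
      ((kept B K (List.ofFn P)).map W).sum := by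
  refine (measurable_kept_comp (fun s (_ : Unit) => (s.map W).sum) (fun n => ?_) hB K).comp
    (measurable_id.prodMk (measurable_const (a := ())))
  simp only [List.map_ofFn, List.sum_ofFn]
  exact Finset.measurable_sum _ fun i _ =>
    hW.comp ((measurable_pi_apply i).comp measurable_fst)

lemma measure_kept_sum_ge_le {B : Set (Cube d)} (hB : MeasurableSet B)
    {W : Cube d × unitInterval → ℝ} (hW : Measurable W) (hW1 : ∀ z, |W z| ≤ 1)
    {t : ℝ} (ht : 0 ≤ t) (M K : ℕ) :
    Measure.pi (fun _ => D) {P : Fin M → Cube d × unitInterval |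
      (kept B K (List.ofFn P)).length = K ∧
      K * ((∫ z in Prod.fst ⁻¹' B, W z ∂D) / D.real (Prod.fst ⁻¹' B) + t) ≤
        ((kept B K (List.ofFn P)).map W).sum} ≤ ENNReal.ofReal (Real.exp (-(K * t ^ 2 / 2))) := by
  set m := (∫ z in Prod.fst ⁻¹' B, W z ∂D) / D.real (Prod.fst ⁻¹' B) with hm
  have hV : Measurable fun z => t * (W z - m) := (hW.sub_const _).const_mul _
  have hprod : ∀ l : List (Cube d × unitInterval),
      (l.map fun z => ENNReal.ofReal (Real.exp (t * (W z - m)))).prod =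
        ENNReal.ofReal (Real.exp (l.map fun z => t * (W z - m)).sum) := fun l => by
    induction l with
    | nil => simp
    | cons z l ih =>
      simp only [List.map_cons, List.prod_cons, List.sum_cons, ih]
      rw [Real.exp_add, ENNReal.ofReal_mul (Real.exp_pos _).le]
  have hsum : ∀ l : List (Cube d × unitInterval),
      (l.map fun z => t * (W z - m)).sum = t * ((l.map W).sum - l.length * m) := fun l => by
    induction l with
    | nil => simp
    | cons z l ih =>
      simp only [List.map_cons, List.sum_cons, ih, List.length_cons]
      push_cast
      ring
  have h1 := lintegral_kept_prod_le (D := D) hB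
    (w := fun z => ENNReal.ofReal (Real.exp (t * (W z - m)))) (fun z => ENNReal.ofReal_ne_top)
    (a := ENNReal.ofReal (Real.exp (t ^ 2 / 2)))
    (ENNReal.one_le_ofReal.2 (Real.one_le_exp (by positivity)))
    (lintegral_exp_le hW hW1 t) M K
  simp only [hprod] at h1
  have h2 := meas_ge_le_lintegral_div (μ := Measure.pi fun _ : Fin M => D)
    (f := fun P : Fin M → Cube d × unitInterval => ENNReal.ofReal (Real.exp
      ((kept B K (List.ofFn P)).map fun z => t * (W z - m)).sum))
    (measurable_kept_sum hV hB K).exp.ennreal_ofReal.aemeasurable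
    -- The Chernoff parameter is the deviation `t` itself, which is optimal here: the exponent
    -- becomes `K * t ^ 2 / 2 - K * t ^ 2`.
    (ε := ENNReal.ofReal (Real.exp (K * t ^ 2)))
    (by simpa using Real.exp_pos _) ENNReal.ofReal_ne_top
  refine (measure_mono ?_).trans (h2.trans ?_)
  · rintro P ⟨hlen, hP⟩
    refine ENNReal.ofReal_le_ofReal (Real.exp_le_exp.2 ?_)
    rw [hsum, hlen]
    have := mul_le_mul_of_nonneg_left hP ht
    linarith
  · refine (ENNReal.div_le_div_right h1 _).trans (le_of_eq ?_)
    rw [← ENNReal.ofReal_pow (Real.exp_pos _).le, ← ENNReal.ofReal_div_of_pos (Real.exp_pos _),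
      ← Real.exp_nat_mul, ← Real.exp_sub]
    congr 2
    ring

end LocalLip

/-! ### Nets of the Lipschitz class and the excess error in one box. -/

namespace LocalLip

open scoped ENNReal

variable {d M N : ℕ}

/-- The loss of the prediction function `f` on a labeled point. -/
noncomputable def loss (f : Cube d → unitInterval) (z : Cube d × unitInterval) : ℝ :=
  |(z.2 : ℝ) - f z.1|

lemma loss_nonneg (f : Cube d → unitInterval) (z : Cube d × unitInterval) : 0 ≤ loss f z :=
  abs_nonneg _

lemma loss_le_one (f : Cube d → unitInterval) (z : Cube d × unitInterval) : loss f z ≤ 1 := by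
  have h1 := z.2.2
  have h2 := (f z.1).2
  refine abs_le.2 ⟨?_, ?_⟩ <;> linarith [h1.1, h1.2, h2.1, h2.2]

lemma abs_loss_sub_loss_le_one (f g : Cube d → unitInterval) (z : Cube d × unitInterval) :
    |loss f z - loss g z| ≤ 1 :=
  abs_le.2 ⟨by linarith [loss_nonneg f z, loss_le_one g z],
    by linarith [loss_nonneg g z, loss_le_one f z]⟩

lemma loss_le_add (f g : Cube d → unitInterval) (z : Cube d × unitInterval) :
    loss f z ≤ loss g z + |(f z.1 : ℝ) - g z.1| := by
  have h : (z.2 : ℝ) - f z.1 = (z.2 - g z.1) - (f z.1 - g z.1) := by ring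
  unfold loss
  rw [h]
  exact abs_sub _ _

lemma measurable_loss {f : Cube d → unitInterval} (hf : Measurable f) : Measurable (loss f) := by
  unfold loss
  simp only [← Real.norm_eq_abs]
  exact ((measurable_subtype_coe.comp measurable_snd).sub
    (measurable_subtype_coe.comp (hf.comp measurable_fst))).norm

lemma lipClass_measurable {L : ℝ} (hL : 0 ≤ L) {f : Cube d → unitInterval}
    (hf : f ∈ lipClass d L) : Measurable f := (lipClass_continuous hL hf).measurable

section

variable {D : Measure (Cube d × unitInterval)} [IsProbabilityMeasure D]

lemma integrable_loss {f : Cube d → unitInterval} (hf : Measurable f) :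
    Integrable (loss f) D :=
  Integrable.of_bound (measurable_loss hf).aestronglyMeasurable 1
    (Filter.Eventually.of_forall fun z => by
      rw [Real.norm_eq_abs, abs_of_nonneg (loss_nonneg f z)]
      exact loss_le_one f z)

end

/-- Record the values at `(r + 1) ^ d` grid points, rounded to multiples of `δ`. Functions with
equal codes differ by at most `δ` at grid points, and moving to a grid point costs `δ` for each of
the two functions. -/
lemma exists_net {L : ℝ} (hL : 0 ≤ L) {lo hi : Fin d → ℝ} {s : ℝ} (hs : 0 < s)
    (hside : ∀ x ∈ box lo hi, ∀ i, (x i : ℝ) - lo i ≤ s) {δ : ℝ} (hδ : 0 < δ) {r q : ℕ}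
    (hr0 : 0 < r) (hr : L * s ≤ δ * r) (hq : 1 / δ < q) :
    ∃ g : ((Fin d → Fin (r + 1)) → Fin q) → lipClass d L, ∀ f ∈ lipClass d L, ∃ k,
      ∀ x ∈ box lo hi, |(f x : ℝ) - (g k : Cube d → unitInterval) x| ≤ 3 * δ := by
  classical
  have hr0' : (0 : ℝ) < r := by exact_mod_cast hr0
  let rep : (Fin d → Fin (r + 1)) → Cube d := fun j i =>
    Set.projIcc 0 1 zero_le_one (lo i + (j i : ℕ) * (s / r))
  let code : lipClass d L → (Fin d → Fin (r + 1)) → Fin q := fun f j =>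
    ⟨⌊((f : Cube d → unitInterval) (rep j) : ℝ) / δ⌋₊, by
      have h1 := ((f : Cube d → unitInterval) (rep j)).2
      have h2 : (((f : Cube d → unitInterval) (rep j) : ℝ)) / δ ≤ 1 / δ :=
        div_le_div_of_nonneg_right h1.2 hδ.le
      have h3 := Nat.floor_le (div_nonneg h1.1 hδ.le)
      exact_mod_cast h3.trans_lt (h2.trans_lt hq)⟩
  have : Nonempty (lipClass d L) := ⟨⟨fun _ => 1, fun x y => by
    simpa using mul_nonneg hL dist_nonneg⟩⟩
  -- The net consists of one Lipschitz function for each attained code; the values at other codes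
  -- are irrelevant.
  refine ⟨Function.invFun code, fun f hf => ⟨code ⟨f, hf⟩, fun x hx => ?_⟩⟩
  set g := Function.invFun code (code ⟨f, hf⟩) with hg
  have hcode : code g = code ⟨f, hf⟩ := Function.invFun_eq ⟨⟨f, hf⟩, rfl⟩
  have hlt : ∀ i, ⌊((x i : ℝ) - lo i) / (s / r)⌋₊ < r + 1 := fun i => by
    rw [Nat.lt_succ_iff]
    refine Nat.floor_le_of_le ?_
    rw [div_le_iff₀ (by positivity), mul_div_cancel₀ _ hr0'.ne']
    exact hside x hx i
  set j : Fin d → Fin (r + 1) := fun i => ⟨⌊((x i : ℝ) - lo i) / (s / r)⌋₊, hlt i⟩ with hj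
  have hdist : dist x (rep j) ≤ s / r := by
    refine (dist_pi_le_iff (by positivity)).2 fun i => ?_
    have h1 := (LipschitzWith.projIcc (zero_le_one' ℝ)).dist_le_mul (x i : ℝ)
      (lo i + (j i : ℕ) * (s / r))
    rw [NNReal.coe_one, one_mul, Set.projIcc_val] at h1
    refine h1.trans ?_
    have hsr : 0 < s / r := by positivity
    have h2 := Nat.floor_le (div_nonneg (sub_nonneg.2 (hx i).1) hsr.le)
    have h3 := Nat.lt_floor_add_one (((x i : ℝ) - lo i) / (s / r))
    rw [le_div_iff₀ hsr] at h2
    rw [div_lt_iff₀ hsr] at h3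
    rw [Real.dist_eq, abs_le]
    simp only [hj]
    constructor <;> linarith
  have hLd : L * dist x (rep j) ≤ δ := by
    refine (mul_le_mul_of_nonneg_left hdist hL).trans ?_
    rw [← mul_div_assoc, div_le_iff₀ hr0']
    exact hr
  have hfloor := congrArg Fin.val (congrFun hcode j)
  simp only [code] at hfloor
  have hclose : |(f (rep j) : ℝ) - (g : Cube d → unitInterval) (rep j)| ≤ δ := by
    set u := (f (rep j) : ℝ)
    set v := ((g : Cube d → unitInterval) (rep j) : ℝ)
    have hu : 0 ≤ u := (f (rep j)).2.1
    have hv : 0 ≤ v := ((g : Cube d → unitInterval) (rep j)).2.1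
    have h1 := Nat.floor_le (div_nonneg hu hδ.le)
    have h2 := Nat.lt_floor_add_one (u / δ)
    have h3 := Nat.floor_le (div_nonneg hv hδ.le)
    have h4 := Nat.lt_floor_add_one (v / δ)
    rw [hfloor] at h3 h4
    rw [le_div_iff₀ hδ] at h1 h3
    rw [div_lt_iff₀ hδ] at h2 h4
    rw [abs_le]
    constructor <;> linarith
  have h1 := abs_le.1 ((hf x (rep j)).trans hLd)
  have h2 := abs_le.1 ((g.2 x (rep j)).trans hLd)
  have h3 := abs_le.1 hclose
  rw [abs_le]
  constructor <;> linarith [h1.1, h1.2, h2.1, h2.2, h3.1, h3.2]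

lemma empErr_eq_sum_loss (s : List (Cube d × unitInterval)) (f : Cube d → unitInterval) :
    empErr s f = (s.map (loss f)).sum := rfl

/-- The pools for which the net function `g` looks much better than `f` on the kept points. -/
def badPools (D : Measure (Cube d × unitInterval)) (M : ℕ) (B : Set (Cube d)) (K : ℕ) (δ : ℝ)
    (f g : Cube d → unitInterval) : Set (Fin M → Cube d × unitInterval) :=
  {P | (kept B K (List.ofFn P)).length = K ∧
    K * ((∫ z in Prod.fst ⁻¹' B, (loss f z - loss g z) ∂D) / D.real (Prod.fst ⁻¹' B) + δ) ≤
      ((kept B K (List.ofFn P)).map fun z => loss f z - loss g z).sum}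

lemma measurableSet_badPools {D : Measure (Cube d × unitInterval)} {L : ℝ} (hL : 0 ≤ L) {B : Set (Cube d)} (hB : MeasurableSet B)
    (K : ℕ) (δ : ℝ) {f g : Cube d → unitInterval} (hf : f ∈ lipClass d L)
    (hg : g ∈ lipClass d L) : MeasurableSet (badPools D M B K δ f g) := by
  have hlen : Measurable fun P : Fin M → Cube d × unitInterval =>
      (kept B K (List.ofFn P)).length := by
    refine (measurable_kept_comp (fun s (_ : Unit) => s.length) (fun n => ?_) hB K).comp
      (measurable_id.prodMk (measurable_const (a := ())))
    simp only [List.length_ofFn]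
    exact measurable_const
  refine (hlen (measurableSet_singleton K)).inter ?_
  exact measurableSet_le measurable_const (measurable_kept_sum
    ((measurable_loss (lipClass_measurable hL hf)).sub
      (measurable_loss (lipClass_measurable hL hg))) hB K)

variable {D : Measure (Cube d × unitInterval)} [IsProbabilityMeasure D]

/-- Of the `7 * δ`, two times `3 * δ` pay for replacing the minimizer by a net function, on the
sample and under `D`, and `δ` is the deviation. The competitor `f` is fixed, so only the minimizer
needs the net. -/
lemma integral_excess_le {L : ℝ} (hL : 0 ≤ L) {A : BoxRule d} (hA : IsERMRule L A)
    {f : Cube d → unitInterval} (hf : f ∈ lipClass d L) {lo hi : Fin d → ℝ} {K : ℕ} (hK : 0 < K)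
    {δ : ℝ} {κ : Type*} (g : κ → lipClass d L)
    (hg : ∀ f ∈ lipClass d L, ∃ k, ∀ x ∈ box lo hi,
      |(f x : ℝ) - (g k : Cube d → unitInterval) x| ≤ 3 * δ)
    {P : Fin M → Cube d × unitInterval}
    (hlen : (kept (box lo hi) K (List.ofFn P)).length = K)
    (hgood : ∀ k, P ∉ badPools D M (box lo hi) K δ f (g k)) :
    ∫ z in Prod.fst ⁻¹' box lo hi,
      (loss (A lo hi (kept (box lo hi) K (List.ofFn P))) z - loss f z) ∂D ≤
        7 * δ * D.real (Prod.fst ⁻¹' box lo hi) := by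
  have hS : MeasurableSet (Prod.fst ⁻¹' box lo hi : Set (Cube d × unitInterval)) :=
    measurable_fst (measurableSet_box lo hi)
  set S : Set (Cube d × unitInterval) := Prod.fst ⁻¹' box lo hi with hSdef
  set l := kept (box lo hi) K (List.ofFn P) with hl
  obtain ⟨f', hf', hmin, heq⟩ := hA.erm lo hi l
  obtain ⟨k, hk⟩ := hg f' hf'
  have hK' : (0 : ℝ) < K := by exact_mod_cast hK
  have hfi := integrable_loss (D := D) (lipClass_measurable hL hf)
  have hfi' := integrable_loss (D := D) (lipClass_measurable hL hf')
  have hgi := integrable_loss (D := D) (lipClass_measurable hL (g k).2)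
  set I := ∫ z in S, (loss f z - loss (g k : Cube d → unitInterval) z) ∂D with hI
  have hlow : -(4 * δ) * D.real S ≤ I := by
    have h1 : (l.map fun z => loss f z - loss (g k : Cube d → unitInterval) z).sum <
        K * (I / D.real S + δ) := by
      by_contra! h
      exact hgood k ⟨hlen, h⟩
    have h2 : ∀ l' : List (Cube d × unitInterval), (∀ z ∈ l', z.1 ∈ box lo hi) →
        (l'.map (loss f)).sum - (l'.map (loss f')).sum - 3 * δ * l'.length ≤
        (l'.map fun z => loss f z - loss (g k : Cube d → unitInterval) z).sum := fun l' => by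
      induction l' with
      | nil => simp
      | cons z l' ih =>
        intro hz
        have h3 := ih fun w hw => hz w (List.mem_cons_of_mem _ hw)
        have h4 := loss_le_add (g k : Cube d → unitInterval) f' z
        have h5 := hk z.1 (hz z List.mem_cons_self)
        rw [abs_sub_comm] at h5
        simp only [List.map_cons, List.sum_cons, List.length_cons]
        push_cast
        linarith
    have h3 := h2 l fun z hz => mem_of_mem_kept hz
    have h4 := hmin f hf
    rw [empErr_eq_sum_loss, empErr_eq_sum_loss] at h4
    rw [hlen] at h3
    have h5 : 0 < K * (I / D.real S + 4 * δ) := by linarith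
    have h6 := pos_of_mul_pos_right h5 hK'.le
    rcases (measureReal_nonneg (μ := D) (s := S)).eq_or_lt with h0 | h0
    · have : I = 0 := by
        rw [hI, Measure.restrict_eq_zero.2, integral_zero_measure]
        exact (measureReal_eq_zero_iff).1 h0.symm
      rw [this, ← h0]
      simp
    · have h7 : -(4 * δ) < I / D.real S := by linarith
      exact ((lt_div_iff₀ h0).1 h7).le
  have hcongr : ∫ z in S, (loss (A lo hi l) z - loss f z) ∂D =
      ∫ z in S, (loss f' z - loss f z) ∂D := by
    refine setIntegral_congr_fun hS fun z hz => ?_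
    simp only [loss, heq z.1 hz]
  have hup : ∫ z in S, (loss f' z - loss (g k : Cube d → unitInterval) z) ∂D ≤
      3 * δ * D.real S := by
    have h1 : ∫ z in S, (loss f' z - loss (g k : Cube d → unitInterval) z) ∂D ≤
        ∫ _ in S, 3 * δ ∂D := by
      refine setIntegral_mono_on (hfi'.sub hgi).integrableOn (integrable_const _) hS
        fun z hz => ?_
      have h4 := loss_le_add f' (g k : Cube d → unitInterval) z
      have h5 := hk z.1 hz
      linarith
    refine h1.trans (le_of_eq ?_)
    rw [setIntegral_const, smul_eq_mul, mul_comm]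
  have hsplit : ∫ z in S, (loss f' z - loss f z) ∂D =
      ∫ z in S, (loss f' z - loss (g k : Cube d → unitInterval) z) ∂D - I := by
    rw [hI]
    refine Eq.trans ?_ (integral_sub (f := fun z => loss f' z - loss (g k) z)
      (g := fun z => loss f z - loss (g k) z)
      (hfi'.sub hgi).integrableOn (hfi.sub hgi).integrableOn)
    simp only [sub_sub_sub_cancel_right]
  rw [hcongr, hsplit]
  linarith

/-- The majorant `U` is visibly measurable, which lets the integrals be added over the boxes. Its
three terms stand for good pools, short lists and bad pools; in the last two cases the excess is
bounded by the mass of the box. -/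
lemma exists_excess_bound {L : ℝ} (hL : 0 ≤ L) {A : BoxRule d} (hA : IsERMRule L A)
    {f : Cube d → unitInterval} (hf : f ∈ lipClass d L) {lo hi : Fin d → ℝ} {K : ℕ} (hK : 0 < K)
    (hM : 0 < M) {δ : ℝ} (hδ : 0 ≤ δ) {κ : Type*} [Fintype κ] (g : κ → lipClass d L)
    (hg : ∀ f ∈ lipClass d L, ∃ k, ∀ x ∈ box lo hi,
      |(f x : ℝ) - (g k : Cube d → unitInterval) x| ≤ 3 * δ)
    {β : ℝ≥0∞} (hβ : Fintype.card κ * ENNReal.ofReal (Real.exp (-(K * δ ^ 2 / 2))) ≤ β) :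
    ∃ U : (Fin M → Cube d × unitInterval) → ℝ≥0∞, Measurable U ∧
      (∀ P, ENNReal.ofReal (∫ z in Prod.fst ⁻¹' box lo hi,
        (loss (A lo hi (kept (box lo hi) K (List.ofFn P))) z - loss f z) ∂D) ≤ U P) ∧
      ∫⁻ P, U P ∂Measure.pi (fun _ => D) ≤
        (ENNReal.ofReal (7 * δ) + β) * D (Prod.fst ⁻¹' box lo hi) + K / M := by
  classical
  have hB := measurableSet_box lo hi
  set S : Set (Cube d × unitInterval) := Prod.fst ⁻¹' box lo hi with hSdef
  have hS : MeasurableSet S := measurable_fst hB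
  set E : Set (Fin M → Cube d × unitInterval) := ⋃ k, badPools D M (box lo hi) K δ f (g k) with hE
  have hEm : MeasurableSet E := MeasurableSet.iUnion fun k =>
    measurableSet_badPools hL hB K δ hf (g k).2
  have hEβ : Measure.pi (fun _ => D) E ≤ β := by
    refine le_trans ?_ hβ
    refine (measure_iUnion_fintype_le _ _).trans ?_
    calc _ ≤ ∑ _ : κ, ENNReal.ofReal (Real.exp (-(K * δ ^ 2 / 2))) := by
          refine Finset.sum_le_sum fun k _ => ?_
          exact measure_kept_sum_ge_le hB
            ((measurable_loss (lipClass_measurable hL hf)).sub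
              (measurable_loss (lipClass_measurable hL (g k).2)))
            (fun z => abs_loss_sub_loss_le_one _ _ z) hδ M K
      _ = _ := by simp
  have hshort : Measurable fun P : Fin M → Cube d × unitInterval =>
      (if (kept (box lo hi) K (List.ofFn P)).length < K then 1 else 0 : ℝ≥0∞) := by
    refine (measurable_kept_comp
      (fun s (_ : Unit) => (if s.length < K then 1 else 0 : ℝ≥0∞)) (fun n => ?_) hB K).comp
      (measurable_id.prodMk (measurable_const (a := ())))
    simp only [List.length_ofFn]
    exact measurable_const
  refine ⟨fun P => ENNReal.ofReal (7 * δ) * D S +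
    D S * (if (kept (box lo hi) K (List.ofFn P)).length < K then 1 else 0) +
    E.indicator (fun _ => D S) P, ?_, fun P => ?_, ?_⟩
  · exact (measurable_const.add (hshort.const_mul _)).add (measurable_const.indicator hEm)
  · have htriv : ENNReal.ofReal (∫ z in S,
        (loss (A lo hi (kept (box lo hi) K (List.ofFn P))) z - loss f z) ∂D) ≤ D S := by
      rw [← ofReal_measureReal]
      refine ENNReal.ofReal_le_ofReal ((le_abs_self _).trans ?_)
      rw [← Real.norm_eq_abs]
      refine (norm_setIntegral_le_of_norm_le_const (C := 1) (measure_lt_top D S)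
        fun z _ => abs_loss_sub_loss_le_one _ _ z).trans (one_mul _).le
    beta_reduce
    by_cases h1 : (kept (box lo hi) K (List.ofFn P)).length < K
    · rw [if_pos h1, mul_one]
      exact htriv.trans (le_add_right le_add_self)
    · by_cases h2 : P ∈ E
      · rw [Set.indicator_of_mem h2]
        exact htriv.trans le_add_self
      · refine le_add_right (le_add_right ?_)
        have h3 : (kept (box lo hi) K (List.ofFn P)).length = K :=
          le_antisymm (length_kept_le _ _ _) (not_lt.1 h1)
        rw [← ofReal_measureReal, ← ENNReal.ofReal_mul (by positivity)]
        refine ENNReal.ofReal_le_ofReal (integral_excess_le hL hA hf hK g hg h3 fun k hk => ?_)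
        exact h2 (Set.mem_iUnion.2 ⟨k, hk⟩)
  · rw [lintegral_add_right _ (measurable_const.indicator hEm),
      lintegral_add_right _ (hshort.const_mul _), lintegral_indicator_const hEm,
      lintegral_const_mul _ hshort, lintegral_const, measure_univ, mul_one]
    have h1 := lintegral_length_kept_lt_le (D := D) hB M K
    have h2 : D S * ∫⁻ P : Fin M → Cube d × unitInterval,
        (if (kept (box lo hi) K (List.ofFn P)).length < K then 1 else 0)
          ∂Measure.pi (fun _ => D) ≤ K / M := by
      rw [ENNReal.le_div_iff_mul_le (Or.inl (by exact_mod_cast hM.ne'))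
        (Or.inl (ENNReal.natCast_ne_top M)), mul_comm, ← mul_assoc]
      exact h1
    calc _ ≤ ENNReal.ofReal (7 * δ) * D S + K / M + D S * β := by gcongr
      _ = _ := by ring

end LocalLip

/-! ### Existence of a measurable rule. -/

namespace LocalLip

variable {d M N : ℕ} {L : ℝ}

lemma isClosed_lipClass (d : ℕ) (L : ℝ) : IsClosed (lipClass d L) := by
  have : lipClass d L = ⋂ x, ⋂ y, {f | |(f x : ℝ) - f y| ≤ L * dist x y} := by
    ext f
    simp [lipClass]
  rw [this]
  refine isClosed_iInter fun x => isClosed_iInter fun y => isClosed_le ?_ continuous_const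
  fun_prop

instance compactSpace_lipClass (d : ℕ) (L : ℝ) : CompactSpace (lipClass d L) :=
  isCompact_iff_compactSpace.1 (isClosed_lipClass d L).isCompact

lemma one_mem_lipClass (hL : 0 ≤ L) : (fun _ => 1) ∈ lipClass d L := fun x y => by
  simpa using mul_nonneg hL dist_nonneg

lemma sup_mem_lipClass {f g : Cube d → unitInterval} (hf : f ∈ lipClass d L)
    (hg : g ∈ lipClass d L) : f ⊔ g ∈ lipClass d L := fun x y => by
  have h1 : ∀ z, (((f ⊔ g) z : unitInterval) : ℝ) = max (f z : ℝ) (g z) := fun z =>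
    (Subtype.mono_coe _).map_max
  rw [h1, h1]
  exact (abs_max_sub_max_le_max _ _ _ _).trans (max_le (hf x y) (hg x y))

lemma inf_mem_lipClass {f g : Cube d → unitInterval} (hf : f ∈ lipClass d L)
    (hg : g ∈ lipClass d L) : f ⊓ g ∈ lipClass d L := fun x y => by
  have h1 : ∀ z, (((f ⊓ g) z : unitInterval) : ℝ) = min (f z : ℝ) (g z) := fun z =>
    (Subtype.mono_coe _).map_min
  rw [h1, h1]
  exact (abs_min_sub_min_le_max _ _ _ _).trans (max_le (hf x y) (hg x y))

/-- The empirical error is modular on the lattice of functions, so the minimizers are closed under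
`⊔`. -/
lemma empErr_sup_add_empErr_inf (s : List (Cube d × unitInterval)) (f g : Cube d → unitInterval) :
    empErr s (f ⊔ g) + empErr s (f ⊓ g) = empErr s f + empErr s g := by
  induction s with
  | nil => simp [empErr]
  | cons z s ih =>
    simp only [empErr, List.map_cons, List.sum_cons, Pi.sup_apply, Pi.inf_apply] at ih ⊢
    rcases le_total (f z.1) (g z.1) with h | h
    · rw [sup_eq_right.2 h, inf_eq_left.2 h]
      linarith
    · rw [sup_eq_left.2 h, inf_eq_right.2 h]
      linarith

lemma continuous_eval_lipClass (hL : 0 ≤ L) :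
    Continuous fun q : lipClass d L × Cube d => (q.1 : Cube d → unitInterval) q.2 := by
  refine continuous_prod_of_continuous_lipschitzWith' _ ⟨L, hL⟩ (fun f => ?_) fun x => ?_
  · refine LipschitzWith.of_dist_le_mul fun x y => ?_
    rw [Subtype.dist_eq, Real.dist_eq]
    exact f.2 x y
  · exact (continuous_apply x).comp continuous_subtype_val

lemma continuous_empErr (hL : 0 ≤ L) (n : ℕ) :
    Continuous fun q : (Fin n → Cube d × unitInterval) × lipClass d L =>
      empErr (List.ofFn q.1) (q.2 : Cube d → unitInterval) := by
  simp only [empErr, List.map_ofFn, List.sum_ofFn, Function.comp_def]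
  refine continuous_finsetSum _ fun i _ => ?_
  have h : Continuous fun q : (Fin n → Cube d × unitInterval) × lipClass d L =>
      (q.2 : Cube d → unitInterval) (q.1 i).1 :=
    (continuous_eval_lipClass hL).comp (continuous_snd.prodMk
      (continuous_fst.comp ((continuous_apply i).comp continuous_fst)))
  have h2 : Continuous fun q : (Fin n → Cube d × unitInterval) × lipClass d L => (q.1 i).2 :=
    continuous_snd.comp ((continuous_apply i).comp continuous_fst)
  exact ((continuous_subtype_val.comp h2).sub (continuous_subtype_val.comp h)).abs

/-- The empirical risk minimizers over the Lipschitz class. -/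
def minimizers (d : ℕ) (L : ℝ) (s : List (Cube d × unitInterval)) : Set (lipClass d L) :=
  {f | ∀ g : lipClass d L, empErr s (f : Cube d → unitInterval) ≤ empErr s g}

lemma isClosed_minimizers_graph (hL : 0 ≤ L) (n : ℕ) :
    IsClosed {q : (Fin n → Cube d × unitInterval) × lipClass d L |
      q.2 ∈ minimizers d L (List.ofFn q.1)} := by
  have : {q : (Fin n → Cube d × unitInterval) × lipClass d L |
      q.2 ∈ minimizers d L (List.ofFn q.1)} = ⋂ g : lipClass d L,
        {q | empErr (List.ofFn q.1) (q.2 : Cube d → unitInterval) ≤ empErr (List.ofFn q.1) g} := by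
    ext q
    simp [minimizers]
  rw [this]
  exact isClosed_iInter fun g => isClosed_le (continuous_empErr hL n)
    ((continuous_empErr hL n).comp (continuous_fst.prodMk (continuous_const (y := g))))

lemma isCompact_minimizers (hL : 0 ≤ L) (s : List (Cube d × unitInterval)) :
    IsCompact (minimizers d L s) := by
  refine IsClosed.isCompact ?_
  have h := (isClosed_minimizers_graph (d := d) hL s.length).preimage
    ((continuous_const (y := s.get)).prodMk (continuous_id (X := lipClass d L)))
  simpa using h

lemma minimizers_nonempty (hL : 0 ≤ L) (s : List (Cube d × unitInterval)) :
    (minimizers d L s).Nonempty := by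
  have hc : Continuous fun f : lipClass d L => empErr s (f : Cube d → unitInterval) := by
    have h := (continuous_empErr (d := d) hL s.length).comp
      ((continuous_const (y := s.get)).prodMk (continuous_id (X := lipClass d L)))
    simpa [Function.comp_def] using h
  obtain ⟨f, -, hf⟩ := isCompact_univ.exists_isMinOn
    ⟨(⟨fun _ => 1, one_mem_lipClass hL⟩ : lipClass d L), trivial⟩ hc.continuousOn
  exact ⟨f, fun g => hf (Set.mem_univ g)⟩

lemma exists_max_minimizer (hL : 0 ≤ L) (s : List (Cube d × unitInterval)) (x : Cube d) :
    ∃ f ∈ minimizers d L s, ∀ g ∈ minimizers d L s,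
      (g : Cube d → unitInterval) x ≤ (f : Cube d → unitInterval) x := by
  obtain ⟨f, hf, hmax⟩ := (isCompact_minimizers hL s).exists_isMaxOn (minimizers_nonempty hL s)
    ((continuous_apply x).comp continuous_subtype_val).continuousOn
  exact ⟨f, hf, fun g hg => hmax hg⟩

/-- The largest empirical risk minimizer. -/
noncomputable def topMinimizer (hL : 0 ≤ L) (s : List (Cube d × unitInterval)) (x : Cube d) :
    unitInterval :=
  ((exists_max_minimizer hL s x).choose : Cube d → unitInterval) x

lemma le_topMinimizer (hL : 0 ≤ L) {s : List (Cube d × unitInterval)} {f : lipClass d L}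
    (hf : f ∈ minimizers d L s) (x : Cube d) :
    (f : Cube d → unitInterval) x ≤ topMinimizer hL s x :=
  (exists_max_minimizer hL s x).choose_spec.2 f hf

lemma exists_eq_topMinimizer (hL : 0 ≤ L) (s : List (Cube d × unitInterval)) (x : Cube d) :
    ∃ f ∈ minimizers d L s, (f : Cube d → unitInterval) x = topMinimizer hL s x :=
  ⟨_, (exists_max_minimizer hL s x).choose_spec.1, rfl⟩

lemma topMinimizer_mem_lipClass (hL : 0 ≤ L) (s : List (Cube d × unitInterval)) :
    topMinimizer hL s ∈ lipClass d L := by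
  have key : ∀ x y, (topMinimizer hL s x : ℝ) - topMinimizer hL s y ≤ L * dist x y := by
    intro x y
    obtain ⟨f, hf, hfx⟩ := exists_eq_topMinimizer hL s x
    have h1 : ((f : Cube d → unitInterval) y : ℝ) ≤ topMinimizer hL s y := le_topMinimizer hL hf y
    have h2 := (le_abs_self _).trans (f.2 x y)
    rw [hfx] at h2
    linarith
  intro x y
  rw [abs_sub_le_iff]
  refine ⟨key x y, ?_⟩
  rw [dist_comm]
  exact key y x

lemma sup_mem_minimizers {s : List (Cube d × unitInterval)} {f g : lipClass d L}
    (hf : f ∈ minimizers d L s) (hg : g ∈ minimizers d L s) :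
    (⟨(f : Cube d → unitInterval) ⊔ g, sup_mem_lipClass f.2 g.2⟩ : lipClass d L) ∈
      minimizers d L s := fun h => by
  have h1 := empErr_sup_add_empErr_inf s (f : Cube d → unitInterval) g
  have h2 := hf ⟨_, inf_mem_lipClass f.2 g.2⟩
  have h3 := hg h
  simp only at h2 ⊢
  linarith

/-- Only finitely many points enter, and a finite supremum of minimizers is a minimizer that reaches
the maximal value at each of them. -/
lemma empErr_topMinimizer_le (hL : 0 ≤ L) (s : List (Cube d × unitInterval))
    {g : Cube d → unitInterval} (hg : g ∈ lipClass d L) :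
    empErr s (topMinimizer hL s) ≤ empErr s g := by
  have key : ∀ l : List (Cube d × unitInterval), ∃ f ∈ minimizers d L s, ∀ z ∈ l,
      (f : Cube d → unitInterval) z.1 = topMinimizer hL s z.1 := fun l => by
    induction l with
    | nil =>
      obtain ⟨f, hf⟩ := minimizers_nonempty hL s
      exact ⟨f, hf, by simp⟩
    | cons z l ih =>
      obtain ⟨f, hf, hfl⟩ := ih
      obtain ⟨f', hf', hfz⟩ := exists_eq_topMinimizer hL s z.1
      refine ⟨_, sup_mem_minimizers hf hf', fun w hw => ?_⟩
      simp only [Pi.sup_apply]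
      rcases List.mem_cons.1 hw with rfl | hw
      · rw [hfz]
        exact sup_eq_right.2 (le_topMinimizer hL hf _)
      · rw [hfl w hw]
        exact sup_eq_left.2 (le_topMinimizer hL hf' _)
  obtain ⟨f, hf, hfs⟩ := key s
  have h1 : empErr s (topMinimizer hL s) = empErr s (f : Cube d → unitInterval) := by
    unfold empErr
    congr 1
    refine List.map_congr_left fun z hz => ?_
    rw [hfs z hz]
  rw [h1]
  exact hf ⟨g, hg⟩

/-- The set is the projection of a closed set along the compact factor `lipClass d L`. This
semicontinuity replaces a measurable selection. -/
lemma isClosed_le_topMinimizer (hL : 0 ≤ L) (n : ℕ) (x : Cube d) (t : ℝ) :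
    IsClosed {s : Fin n → Cube d × unitInterval |
      t ≤ (topMinimizer hL (List.ofFn s) x : ℝ)} := by
  have h1 : IsClosed {q : (Fin n → Cube d × unitInterval) × lipClass d L |
      t ≤ ((q.2 : Cube d → unitInterval) x : ℝ)} :=
    isClosed_le continuous_const (continuous_subtype_val.comp ((continuous_apply x).comp
      (continuous_subtype_val.comp continuous_snd)))
  have h2 := isClosedMap_fst_of_compactSpace _ ((isClosed_minimizers_graph hL n).inter h1)
  convert! h2 using 1
  ext s
  simp only [Set.mem_ofPred_eq, Set.mem_image, Set.mem_inter_iff, Prod.exists]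
  constructor
  · intro hs
    obtain ⟨f, hf, hfx⟩ := exists_eq_topMinimizer hL (List.ofFn s) x
    exact ⟨s, f, ⟨hf, by rwa [hfx]⟩, rfl⟩
  · rintro ⟨s', f, ⟨hf, hfx⟩, rfl⟩
    exact hfx.trans (le_topMinimizer hL hf x)

/-- The McShane extension of the largest empirical risk minimizer on a box. -/
noncomputable def mcShane (hL : 0 ≤ L) (lo hi : Fin d → ℝ) (s : List (Cube d × unitInterval))
    (x : Cube d) : ℝ :=
  ⨅ y : box lo hi, ((topMinimizer hL s y : ℝ) + L * dist x y)

lemma bddBelow_mcShane (hL : 0 ≤ L) (lo hi : Fin d → ℝ) (s : List (Cube d × unitInterval))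
    (x : Cube d) :
    BddBelow (Set.range fun y : box lo hi => (topMinimizer hL s y : ℝ) + L * dist x y) := by
  refine ⟨0, ?_⟩
  rintro _ ⟨y, rfl⟩
  exact add_nonneg (topMinimizer hL s y).2.1 (mul_nonneg hL dist_nonneg)

lemma mcShane_sub_le (hL : 0 ≤ L) {lo hi : Fin d → ℝ} (hne : (box lo hi).Nonempty)
    (s : List (Cube d × unitInterval)) (x y : Cube d) :
    mcShane hL lo hi s x - mcShane hL lo hi s y ≤ L * dist x y := by
  have : Nonempty (box lo hi) := hne.to_subtype
  rw [sub_le_comm]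
  refine le_ciInf fun z => ?_
  have h1 := ciInf_le (bddBelow_mcShane hL lo hi s x) z
  have h2 := mul_le_mul_of_nonneg_left (dist_triangle x y z) hL
  unfold mcShane
  linarith

lemma mcShane_eq (hL : 0 ≤ L) {lo hi : Fin d → ℝ} (s : List (Cube d × unitInterval))
    {x : Cube d} (hx : x ∈ box lo hi) : mcShane hL lo hi s x = topMinimizer hL s x := by
  have : Nonempty (box lo hi) := ⟨⟨x, hx⟩⟩
  refine le_antisymm ?_ (le_ciInf fun z => ?_)
  · exact (ciInf_le (bddBelow_mcShane hL lo hi s x) ⟨x, hx⟩).trans (by simp)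
  · have := (le_abs_self _).trans (topMinimizer_mem_lipClass hL s x z)
    linarith

lemma one_le_mcShane (hL : 0 < L) {lo hi : Fin d → ℝ} (hne : (box lo hi).Nonempty)
    (s : List (Cube d × unitInterval)) {x : Cube d}
    (hx : ∃ i, (x i : ℝ) = lo i - 1 / L ∨ (x i : ℝ) = hi i + 1 / L) :
    1 ≤ mcShane hL.le lo hi s x := by
  have : Nonempty (box lo hi) := hne.to_subtype
  refine le_ciInf fun z => ?_
  obtain ⟨i, hi'⟩ := hx
  have hz := z.2 i
  have h1 : 1 / L ≤ dist x z := by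
    refine le_trans ?_ (dist_le_pi_dist x (z : Cube d) i)
    rw [Subtype.dist_eq, Real.dist_eq]
    rcases hi' with h | h
    · rw [abs_sub_comm]
      exact le_trans (by linarith) (le_abs_self _)
    · exact le_trans (by linarith) (le_abs_self _)
  have h2 := mul_le_mul_of_nonneg_left h1 hL.le
  rw [mul_one_div_cancel hL.ne'] at h2
  linarith [(topMinimizer hL.le s z).2.1]

/-- An infimum of upper semicontinuous functions is upper semicontinuous, even over uncountably many
`y`. -/
lemma measurable_mcShane (hL : 0 ≤ L) (lo hi : Fin d → ℝ) (n : ℕ) (x : Cube d) :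
    Measurable fun s : Fin n → Cube d × unitInterval => mcShane hL lo hi (List.ofFn s) x := by
  have h : UpperSemicontinuous fun s : Fin n → Cube d × unitInterval =>
      mcShane hL lo hi (List.ofFn s) x := by
    refine upperSemicontinuous_ciInf (fun s => bddBelow_mcShane hL lo hi (List.ofFn s) x)
      fun y => ?_
    rw [upperSemicontinuous_iff_isClosed_preimage]
    intro t
    convert! isClosed_le_topMinimizer hL n (y : Cube d) (t - L * dist x y) using 1
    ext s
    simp only [Set.mem_preimage, Set.mem_Ici, Set.mem_ofPred_eq, sub_le_iff_le_add]
  exact measurable_of_Ici fun t => (h.isClosed_preimage t).measurableSet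

open Classical in
/-- A measurable rule: the McShane extension of the largest empirical risk minimizer. -/
noncomputable def mcShaneRule (hL : 0 ≤ L) : BoxRule d := fun lo hi s x =>
  if (box lo hi).Nonempty then Set.projIcc 0 1 zero_le_one (mcShane hL lo hi s x) else 1

theorem isERMRule_mcShaneRule (hL : 0 < L) :
    IsERMRule L (mcShaneRule hL.le : BoxRule d) where
  erm lo hi s := by
    refine ⟨topMinimizer hL.le s, topMinimizer_mem_lipClass hL.le s,
      fun g hg => empErr_topMinimizer_le hL.le s hg, fun x hx => ?_⟩
    unfold mcShaneRule
    rw [if_pos ⟨x, hx⟩, mcShane_eq hL.le s hx, Set.projIcc_val]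
  lipschitz lo hi s x _ y _ := by
    unfold mcShaneRule
    split_ifs with hne
    · have h := (LipschitzWith.projIcc (zero_le_one' ℝ)).dist_le_mul
        (mcShane hL.le lo hi s x) (mcShane hL.le lo hi s y)
      rw [NNReal.coe_one, one_mul, Subtype.dist_eq, Real.dist_eq] at h
      refine h.trans ?_
      rw [Real.dist_eq, abs_sub_le_iff]
      refine ⟨mcShane_sub_le hL.le hne s x y, ?_⟩
      rw [dist_comm]
      exact mcShane_sub_le hL.le hne s y x
    · simpa using mul_nonneg hL.le dist_nonneg
  eq_one lo hi s x _ hx := by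
    unfold mcShaneRule
    split_ifs with hne
    · exact Set.projIcc_of_right_le _ (one_le_mcShane hL hne s hx)
    · rfl
  measurable lo hi x n := by
    unfold mcShaneRule
    split_ifs with hne
    · exact continuous_projIcc.measurable.comp (measurable_mcShane hL.le lo hi n x)
    · exact measurable_const

end LocalLip

/-! ### Averages over offsets, test points and pools. -/

namespace LocalLip

open scoped ENNReal

variable {d M N : ℕ}

/-! The offsets for which a point is not in a long box. -/

lemma exists_between_right_left {G : Grid d} (hG : G.Proper) (i : Fin d) {u : ℝ} (hu0 : 0 ≤ u)
    (hu1 : u ≤ 1) (hu : ∀ k, G.left i k < 1 → G.left i k ≤ u → G.right i k < u) :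
    ∃ k, G.right i k < u ∧ u ≤ G.right i k + 2 / G.L := by
  have hex : ∃ k, u ≤ G.right i k := by
    obtain ⟨k, hk⟩ := exists_nat_ge (u / G.period)
    refine ⟨k, ?_⟩
    have h1 := (div_le_iff₀ hG.period_pos).1 hk
    have h2 := hG.offset_nonneg i
    simp only [Grid.right]
    linarith
  classical
  -- The first long interval ending at or after `u` must start after `u`, so `u` lies in the short
  -- interval before it.
  have hspec := Nat.find_spec hex
  have h0 : Nat.find hex ≠ 0 := fun h => by
    rw [h] at hspec
    exact absurd hspec (not_le.2 (hu 0 (by simp [Grid.left]) hu0))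
  obtain ⟨k, hk⟩ := Nat.exists_eq_succ_of_ne_zero h0
  refine ⟨k, not_le.1 (Nat.find_min hex (by omega)), ?_⟩
  rw [hk] at hspec
  by_contra! h
  have hleft : G.left i (k + 1) = G.right i k + 2 / G.L := by
    simp only [Grid.left, Grid.right]
    ring
  rw [← hleft] at h
  exact absurd hspec (not_le.2 (hu _ (h.trans_le hu1) h.le))

/-- In units of `2 / L` the short intervals have length one, the offsets are integers at most `p`,
and the period is `p + 1`. So short intervals belonging to different pairs of offset and period do
not overlap. -/
lemma offset_le_of_between {L η : ℝ} (hL : 0 < L) {m n n' k k' : ℕ} (hm : m ≤ (d : ℝ) / (2 * η))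
    (hn : n ≤ m) {u : ℝ}
    (h : u ≤ (n : ℝ) * (2 / L) + k * ((2 / L) * (d / (2 * η) + 1)) + 2 / L)
    (h' : (n' : ℝ) * (2 / L) + k' * ((2 / L) * (d / (2 * η) + 1)) < u) : k' ≤ k ∧
      (k = k' → n' ≤ n) := by
  have hc : 0 < 2 / L := by positivity
  set p := (d : ℝ) / (2 * η) with hp
  have h1 : (2 / L) * ((n' : ℝ) + k' * (p + 1)) < (2 / L) * (n + k * (p + 1) + 1) := by
    linarith
  have h2 := lt_of_mul_lt_mul_left h1 hc.le
  have hp0 : 0 ≤ p := le_trans (Nat.cast_nonneg m) hm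
  have hn' : (n : ℝ) ≤ m := by exact_mod_cast hn
  constructor
  · by_contra! hlt
    have h3 : (k : ℝ) + 1 ≤ k' := by exact_mod_cast hlt
    have h4 := mul_le_mul_of_nonneg_right h3 (by linarith : 0 ≤ p + 1)
    have h5 : (0 : ℝ) ≤ n' := Nat.cast_nonneg n'
    linarith
  · rintro rfl
    have h3 : (n' : ℝ) < n + 1 := by linarith
    have : n' < n + 1 := by exact_mod_cast h3
    omega

lemma offsetGrid_proper {L η : ℝ} (hL : 0 < L) (hη : 0 < η) {n : ℕ} (o : Fin d → Fin n) :
    (offsetGrid L η o).Proper :=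
  ⟨hL, hη, fun i => by
    have : 0 ≤ 2 / L := by positivity
    exact mul_nonneg (Nat.cast_nonneg _) this⟩

/-- The labeled points outside all long boxes. -/
def outside (G : Grid d) : Set (Cube d × unitInterval) :=
  {z | ∀ J, G.IsIndex J → z.1 ∉ box (G.lower J) (G.upper J)}

lemma measurableSet_outside (G : Grid d) : MeasurableSet (outside G) := by
  have : outside G = ⋂ J, ⋂ _ : G.IsIndex J, (Prod.fst ⁻¹' box (G.lower J) (G.upper J))ᶜ := by
    ext z
    simp [outside]
  rw [this]
  exact MeasurableSet.iInter fun J => MeasurableSet.iInter fun _ =>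
    (measurable_fst (measurableSet_box _ _)).compl

lemma exists_bad_offset {L η : ℝ} (hL : 0 < L) (hη : 0 < η) (u : unitInterval) (i : Fin d) :
    ∃ v : Fin (maxOffset d η + 1), ∀ o : Fin d → Fin (maxOffset d η + 1),
      (∀ k, (offsetGrid L η o).left i k < 1 → (offsetGrid L η o).left i k ≤ u →
        (offsetGrid L η o).right i k < u) → o i = v := by
  by_cases h : ∃ o : Fin d → Fin (maxOffset d η + 1),
      ∀ k, (offsetGrid L η o).left i k < 1 → (offsetGrid L η o).left i k ≤ u →
        (offsetGrid L η o).right i k < u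
  · obtain ⟨o', ho'⟩ := h
    refine ⟨o' i, fun o ho => ?_⟩
    obtain ⟨k, hk1, hk2⟩ := exists_between_right_left (offsetGrid_proper hL hη o) i u.2.1 u.2.2 ho
    obtain ⟨k', hk1', hk2'⟩ :=
      exists_between_right_left (offsetGrid_proper hL hη o') i u.2.1 u.2.2 ho'
    have hper : (d : ℝ) / (L * η) + 2 / L = (2 / L) * (d / (2 * η) + 1) := by
      field_simp
    simp only [Grid.right, Grid.period, offsetGrid, hper] at hk1 hk2 hk1' hk2'
    have hm : ((maxOffset d η : ℕ) : ℝ) ≤ (d : ℝ) / (2 * η) := Nat.floor_le (by positivity)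
    have h1 := offset_le_of_between hL hm (Nat.lt_succ_iff.1 (o i).2) hk2 hk1'
    have h2 := offset_le_of_between hL hm (Nat.lt_succ_iff.1 (o' i).2) hk2' hk1
    have h3 : k = k' := le_antisymm h2.1 h1.1
    exact Fin.ext (le_antisymm (h2.2 h3.symm) (h1.2 h3))
  · exact ⟨0, fun o ho => absurd ⟨o, ho⟩ h⟩

lemma uniform_apply_eq {n : ℕ} (i : Fin d) (v : Fin (n + 1)) :
    (PMF.uniformOfFintype (Fin d → Fin (n + 1))).toMeasure {o | o i = v} =
      ((n + 1 : ℕ) : ℝ≥0∞)⁻¹ := by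
  classical
  have hd : 0 < d := i.pos
  rw [PMF.toMeasure_uniformOfFintype_apply _ (Set.toFinite _).measurableSet]
  have h1 := Fintype.card_filter_piFinset_const (Finset.univ : Finset (Fin (n + 1))) i v
  simp only [Fintype.piFinset_univ, Finset.mem_univ, if_true, Finset.card_univ,
    Fintype.card_fin] at h1
  have h2 : Fintype.card {o : Fin d → Fin (n + 1) | o i = v} = (n + 1) ^ (d - 1) := by
    rw [← h1, Fintype.card_subtype]
    rfl
  rw [h2, Fintype.card_fun, Fintype.card_fin, Fintype.card_fin]
  obtain ⟨e, rfl⟩ := Nat.exists_eq_succ_of_ne_zero hd.ne'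
  simp only [Nat.succ_eq_add_one, Nat.add_sub_cancel, pow_succ]
  push_cast
  have h3 : ((n : ℝ≥0∞) + 1) ≠ 0 := by simp
  have h4 : ((n : ℝ≥0∞) + 1) ≠ ∞ := by simp
  rw [ENNReal.div_eq_inv_mul, ENNReal.mul_inv (Or.inl (pow_ne_zero _ h3))
    (Or.inl (ENNReal.pow_ne_top h4)), mul_right_comm,
    ENNReal.inv_mul_cancel (pow_ne_zero _ h3) (ENNReal.pow_ne_top h4), one_mul]

/-- A union bound over the axes: each has at most one bad offset among more than `d / (2 * η)`. -/
lemma uniform_outside_le {L η : ℝ} (hL : 0 < L) (hη : 0 < η) (z : Cube d × unitInterval) :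
    (PMF.uniformOfFintype (Fin d → Fin (maxOffset d η + 1))).toMeasure
      {o | z ∈ outside (offsetGrid L η o)} ≤ ENNReal.ofReal (2 * η) := by
  choose v hv using fun i : Fin d => exists_bad_offset (d := d) hL hη (z.1 i) i
  have hsub : {o : Fin d → Fin (maxOffset d η + 1) | z ∈ outside (offsetGrid L η o)} ⊆
      ⋃ i, {o | o i = v i} := by
    intro o ho
    by_contra hno
    simp only [Set.mem_iUnion, Set.mem_ofPred_eq, not_exists] at hno
    have h1 : ∀ i, ∃ k, (offsetGrid L η o).left i k < 1 ∧ (offsetGrid L η o).left i k ≤ z.1 i ∧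
        (z.1 i : ℝ) ≤ (offsetGrid L η o).right i k := fun i => by
      by_contra! h
      exact hno i (hv i o h)
    choose J hJ using h1
    exact ho J (fun i => (hJ i).1) fun i => (hJ i).2
  refine (measure_mono hsub).trans ((measure_iUnion_fintype_le _ _).trans ?_)
  simp only [uniform_apply_eq, Finset.sum_const, Finset.card_univ, Fintype.card_fin,
    nsmul_eq_mul]
  have h1 : (d : ℝ) / (2 * η) < (maxOffset d η + 1 : ℕ) := by
    push_cast
    exact Nat.lt_floor_add_one _
  rw [← div_eq_mul_inv]
  refine ENNReal.div_le_of_le_mul ?_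
  rw [← ENNReal.ofReal_natCast, ← ENNReal.ofReal_natCast, ← ENNReal.ofReal_mul (by positivity)]
  refine ENNReal.ofReal_le_ofReal ?_
  rw [div_lt_iff₀ (by positivity)] at h1
  linarith

lemma lintegral_outside_le {L η : ℝ} (hL : 0 < L) (hη : 0 < η)
    (D : Measure (Cube d × unitInterval)) [IsProbabilityMeasure D] :
    ∫⁻ o, D (outside (offsetGrid L η o))
      ∂(PMF.uniformOfFintype (Fin d → Fin (maxOffset d η + 1))).toMeasure ≤
        ENNReal.ofReal (2 * η) := by
  have hmeas : Measurable (Function.uncurry fun (o : Fin d → Fin (maxOffset d η + 1))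
      (z : Cube d × unitInterval) => (outside (offsetGrid L η o)).indicator
        (fun _ => (1 : ℝ≥0∞)) z) :=
    measurable_from_prod_countable_right fun o =>
      (measurable_const.indicator (measurableSet_outside (offsetGrid L η o)) :
        Measurable ((outside (offsetGrid L η o)).indicator fun _ => (1 : ℝ≥0∞)))
  calc _ = ∫⁻ o, ∫⁻ z, (outside (offsetGrid L η o)).indicator (fun _ => (1 : ℝ≥0∞)) z ∂D
        ∂(PMF.uniformOfFintype (Fin d → Fin (maxOffset d η + 1))).toMeasure := by
        refine lintegral_congr fun o => ?_
        rw [lintegral_indicator_const (measurableSet_outside _), one_mul]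
    _ = ∫⁻ z, ∫⁻ o, (outside (offsetGrid L η o)).indicator (fun _ => (1 : ℝ≥0∞)) z
        ∂(PMF.uniformOfFintype (Fin d → Fin (maxOffset d η + 1))).toMeasure ∂D :=
        lintegral_lintegral_swap hmeas.aemeasurable
    _ ≤ ∫⁻ _, ENNReal.ofReal (2 * η) ∂D := by
        refine lintegral_mono fun z => ?_
        have h1 : (fun o => (outside (offsetGrid L η o)).indicator (fun _ => (1 : ℝ≥0∞)) z) =
            Set.indicator {o : Fin d → Fin (maxOffset d η + 1) |
              z ∈ outside (offsetGrid L η o)} fun _ => 1 := rfl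
        rw [h1, lintegral_indicator_const (Set.toFinite _).measurableSet, one_mul]
        exact uniform_outside_le hL hη z
    _ = _ := by simp

/-! The error on the test points. -/

lemma lintegral_test_le {D : Measure (Cube d × unitInterval)} [IsProbabilityMeasure D]
    {f : Cube d → unitInterval} (hf : Measurable f) (hN : 0 < N) {t : ℝ} (ht : 0 < t)
    (hNt : 1 ≤ N * t ^ 2) :
    ∫⁻ T : Fin N → Cube d × unitInterval, ENNReal.ofReal |(∑ i, loss f (T i)) / N - err D f|
      ∂Measure.pi (fun _ => D) ≤ ENNReal.ofReal t := by
  have hN' : (0 : ℝ) < N := by exact_mod_cast hN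
  have hmem : MemLp (loss f) 2 D := MemLp.of_bound (measurable_loss hf).aestronglyMeasurable 1
    (Filter.Eventually.of_forall fun z => by
      rw [Real.norm_eq_abs, abs_of_nonneg (loss_nonneg f z)]
      exact loss_le_one f z)
  set X : (Fin N → Cube d × unitInterval) → ℝ := ∑ i, fun T => loss f (T i) with hX
  have hXapp : ∀ T, X T = ∑ i, loss f (T i) := fun T => by simp [hX]
  set μ : Measure (Fin N → Cube d × unitInterval) := Measure.pi fun _ => D with hμ
  have hmemi : ∀ i, MemLp (fun T : Fin N → Cube d × unitInterval => loss f (T i)) 2 μ := fun i =>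
    hmem.comp_measurePreserving (measurePreserving_eval (fun _ => D) i)
  have hmemX : MemLp X 2 μ := memLp_finsetSum' _ fun i _ => hmemi i
  have hmean : ∫ T, X T ∂μ = N * err D f := by
    simp only [hXapp]
    rw [integral_finsetSum _ fun i _ => (hmemi i).integrable (by norm_num)]
    have : ∀ i : Fin N, ∫ T : Fin N → Cube d × unitInterval, loss f (T i) ∂μ = err D f :=
      fun i => by
        rw [hμ]
        exact integral_comp_eval (μ := fun _ : Fin N => D) (i := i)
          (measurable_loss hf).aestronglyMeasurable
    simp [this]
  have hvar : ∫ T, (X T - N * err D f) ^ 2 ∂μ ≤ N / 4 := by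
    rw [← hmean, ← ProbabilityTheory.variance_eq_integral hmemX.aestronglyMeasurable.aemeasurable,
      hX, hμ, ProbabilityTheory.variance_sum_pi fun _ => hmem]
    have := ProbabilityTheory.variance_le_sq_of_bounded (μ := D) (X := loss f) (a := 0) (b := 1)
      (Filter.Eventually.of_forall fun z => ⟨loss_nonneg f z, loss_le_one f z⟩)
      (measurable_loss hf).aemeasurable
    simp only [Finset.sum_const, Finset.card_univ, Fintype.card_fin, nsmul_eq_mul]
    have h2 := mul_le_mul_of_nonneg_left this hN'.le
    linarith
  have hint : Integrable (fun T => (X T - N * err D f) ^ 2) μ :=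
    (hmemX.sub (memLp_const _)).integrable_sq
  -- The inequality `|a| ≤ t / 2 + a ^ 2 / (2 * t)` reduces the first moment to the variance.
  have hbound : ∀ T, |(∑ i, loss f (T i)) / N - err D f| ≤
      t / 2 + (2 * t * N ^ 2)⁻¹ * (X T - N * err D f) ^ 2 := fun T => by
    rw [hXapp]
    set a := (∑ i, loss f (T i)) / N - err D f with ha
    have h1 : (∑ i, loss f (T i)) - N * err D f = N * a := by
      rw [ha]
      field_simp
    rw [h1]
    have h2 : (2 * t * (N : ℝ) ^ 2)⁻¹ * (N * a) ^ 2 = a ^ 2 / (2 * t) := by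
      field_simp
    rw [h2]
    have h3 : t / 2 + a ^ 2 / (2 * t) - |a| = (|a| - t) ^ 2 / (2 * t) := by
      rw [← sq_abs a]
      field_simp
      ring
    have h4 : 0 ≤ (|a| - t) ^ 2 / (2 * t) := by positivity
    linarith
  calc _ ≤ ∫⁻ T, ENNReal.ofReal (t / 2 + (2 * t * N ^ 2)⁻¹ * (X T - N * err D f) ^ 2) ∂μ :=
        lintegral_mono fun T => ENNReal.ofReal_le_ofReal (hbound T)
    _ = ENNReal.ofReal (∫ T, (t / 2 + (2 * t * N ^ 2)⁻¹ * (X T - N * err D f) ^ 2) ∂μ) := by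
        rw [ofReal_integral_eq_lintegral_ofReal]
        · exact (integrable_const _).add (hint.const_mul _)
        · exact Filter.Eventually.of_forall fun T => by positivity
    _ ≤ ENNReal.ofReal t := by
        refine ENNReal.ofReal_le_ofReal ?_
        rw [integral_add (integrable_const _) (hint.const_mul _), integral_const_mul]
        have h1 : (2 * t * (N : ℝ) ^ 2)⁻¹ * ∫ T, (X T - N * err D f) ^ 2 ∂μ ≤
            (2 * t * (N : ℝ) ^ 2)⁻¹ * (N / 4) := mul_le_mul_of_nonneg_left hvar (by positivity)
        have h2 : (2 * t * (N : ℝ) ^ 2)⁻¹ * (N / 4) ≤ t / 2 := by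
          rw [inv_mul_le_iff₀ (by positivity)]
          nlinarith
        simp only [integral_const, probReal_univ, smul_eq_mul, one_mul]
        linarith

/-! The excess error of the query function for a fixed grid. -/

variable {D : Measure (Cube d × unitInterval)} [IsProbabilityMeasure D]

lemma err_query_sub_le {G : Grid d} {A : BoxRule d} (hG : G.Proper) (hA : IsERMRule G.L A)
    (cap : ℕ) (P : Fin M → Cube d × unitInterval) {f : Cube d → unitInterval}
    (hf : f ∈ lipClass d G.L) (I : Finset (Fin d → ℕ)) (hI : ∀ J, J ∈ I ↔ G.IsIndex J) :
    err D (query A G cap P) - err D f ≤ D.real (outside G) +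
      ∑ J ∈ I, ∫ z in Prod.fst ⁻¹' box (G.lower J) (G.upper J),
        (loss (A (G.lower J) (G.upper J)
          (kept (box (G.lower J) (G.upper J)) cap (List.ofFn P))) z - loss f z) ∂D := by
  have hfi := integrable_loss (D := D) (lipClass_measurable hG.L_pos.le hf)
  have hqi := integrable_loss (D := D)
    (lipClass_measurable hG.L_pos.le (query_mem_lipClass hG hA cap P))
  have hsub := hqi.sub hfi
  have hSm : ∀ J, MeasurableSet
      (Prod.fst ⁻¹' box (G.lower J) (G.upper J) : Set (Cube d × unitInterval)) := fun J =>
    measurable_fst (measurableSet_box _ _)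
  have h1 : err D (query A G cap P) - err D f =
      ∫ z, (loss (query A G cap P) - loss f) z ∂D := (integral_sub hqi hfi).symm
  have hcompl : (outside G)ᶜ = ⋃ J ∈ I, (Prod.fst ⁻¹' box (G.lower J) (G.upper J)) := by
    ext z
    simp only [outside, Set.mem_compl_iff, Set.mem_ofPred_eq, Set.mem_iUnion, Set.mem_preimage,
      not_forall, not_not, hI]
  rw [h1, ← integral_add_compl (measurableSet_outside G) hsub, hcompl,
    integral_biUnion_finset I (fun J _ => hSm J) ?_ fun J _ => hsub.integrableOn]
  · refine add_le_add ?_ (Finset.sum_le_sum fun J hJ => le_of_eq ?_)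
    · refine (le_abs_self _).trans ?_
      rw [← Real.norm_eq_abs]
      exact (norm_setIntegral_le_of_norm_le_const (C := 1) (measure_lt_top D _)
        fun z _ => abs_loss_sub_loss_le_one _ _ z).trans (one_mul _).le
    · refine setIntegral_congr_fun (hSm J) fun z hz => ?_
      simp only [Pi.sub_apply, loss]
      rw [query_of_mem_extBox hG hA cap P ((hI J).1 hJ) (box_subset_extBox hG.L_pos _ _ hz)]
  · intro J _ J' _ hne
    refine Set.disjoint_left.2 fun z hz hz' => hne ?_
    exact hG.index_unique hz (box_subset_extBox hG.L_pos _ _ hz')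

lemma sum_measure_box_le_one {G : Grid d} (hG : G.Proper) (I : Finset (Fin d → ℕ)) :
    ∑ J ∈ I, D (Prod.fst ⁻¹' box (G.lower J) (G.upper J)) ≤ 1 := by
  rw [← measure_biUnion_finset]
  · exact prob_le_one
  · intro J _ J' _ hne
    refine Set.disjoint_left.2 fun z hz hz' => hne ?_
    exact hG.index_unique hz (box_subset_extBox hG.L_pos _ _ hz')
  · exact fun J _ => measurable_fst (measurableSet_box _ _)

/-- Since the boxes are disjoint, the errors proportional to mass add up to `7 * δ + β`; only `K /
M` is paid once per box. -/
lemma lintegral_err_query_sub_le {G : Grid d} {A : BoxRule d} (hG : G.Proper)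
    (hA : IsERMRule G.L A) {f : Cube d → unitInterval} (hf : f ∈ lipClass d G.L)
    {K : ℕ} (hK : 0 < K) (hM : 0 < M) {δ : ℝ} (hδ : 0 ≤ δ) {κ : Type*} [Fintype κ]
    {β : ℝ≥0∞} (hβ : Fintype.card κ * ENNReal.ofReal (Real.exp (-(K * δ ^ 2 / 2))) ≤ β)
    (hnet : ∀ J, G.IsIndex J → ∃ g : κ → lipClass d G.L, ∀ f ∈ lipClass d G.L, ∃ k,
      ∀ x ∈ box (G.lower J) (G.upper J), |(f x : ℝ) - (g k : Cube d → unitInterval) x| ≤ 3 * δ)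
    (I : Finset (Fin d → ℕ)) (hI : ∀ J, J ∈ I ↔ G.IsIndex J) :
    ∫⁻ P : Fin M → Cube d × unitInterval, ENNReal.ofReal (err D (query A G K P) - err D f)
      ∂Measure.pi (fun _ => D) ≤
        D (outside G) + (ENNReal.ofReal (7 * δ) + β + I.card * (K / M)) := by
  have hU : ∀ J, ∃ U : (Fin M → Cube d × unitInterval) → ℝ≥0∞, J ∈ I → (Measurable U ∧
      (∀ P, ENNReal.ofReal (∫ z in Prod.fst ⁻¹' box (G.lower J) (G.upper J),
        (loss (A (G.lower J) (G.upper J)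
          (kept (box (G.lower J) (G.upper J)) K (List.ofFn P))) z - loss f z) ∂D) ≤ U P) ∧
      ∫⁻ P, U P ∂Measure.pi (fun _ => D) ≤ (ENNReal.ofReal (7 * δ) + β) *
        D (Prod.fst ⁻¹' box (G.lower J) (G.upper J)) + K / M) := fun J => by
    by_cases hJ : J ∈ I
    · obtain ⟨g, hg⟩ := hnet J ((hI J).1 hJ)
      obtain ⟨U, hU⟩ := exists_excess_bound (D := D) hG.L_pos.le hA hf hK hM hδ g hg hβ
      exact ⟨U, fun _ => hU⟩
    · exact ⟨0, fun h => absurd h hJ⟩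
  choose U hU using hU
  calc _ ≤ ∫⁻ P : Fin M → Cube d × unitInterval, (D (outside G) + ∑ J ∈ I, U J P)
        ∂Measure.pi (fun _ => D) := by
        refine lintegral_mono fun P => ?_
        refine (ENNReal.ofReal_le_ofReal (err_query_sub_le hG hA K P hf I hI)).trans ?_
        refine ENNReal.ofReal_add_le.trans ?_
        rw [ofReal_measureReal]
        refine add_le_add_right ?_ _
        have hsum : ∀ (I' : Finset (Fin d → ℕ)) (a : (Fin d → ℕ) → ℝ),
            ENNReal.ofReal (∑ J ∈ I', a J) ≤ ∑ J ∈ I', ENNReal.ofReal (a J) := fun I' a =>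
          Finset.le_sum_of_subadditive ENNReal.ofReal ENNReal.ofReal_zero.le
            (fun _ _ => ENNReal.ofReal_add_le) I' a
        exact (hsum _ _).trans (Finset.sum_le_sum fun J hJ => (hU J hJ).2.1 P)
    _ = D (outside G) + ∑ J ∈ I, ∫⁻ P, U J P ∂Measure.pi (fun _ => D) := by
        rw [lintegral_add_left measurable_const, lintegral_const, measure_univ, mul_one,
          lintegral_finsetSum' _ fun J hJ => (hU J hJ).1.aemeasurable]
    _ ≤ D (outside G) + ∑ J ∈ I, ((ENNReal.ofReal (7 * δ) + β) *
        D (Prod.fst ⁻¹' box (G.lower J) (G.upper J)) + K / M) := by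
        gcongr with J hJ
        exact (hU J hJ).2.2
    _ ≤ _ := by
        rw [Finset.sum_add_distrib, ← Finset.mul_sum, Finset.sum_const, nsmul_eq_mul]
        gcongr
        exact mul_le_of_le_one_right' (sum_measure_box_le_one hG I)

end LocalLip

/-! ### The expected deviation of the estimate. -/

namespace LocalLip

open scoped ENNReal

variable {d M N : ℕ}

lemma Grid.IsIndex.lt {G : Grid d} (hG : G.Proper) {J : Fin d → ℕ} (hJ : G.IsIndex J)
    (i : Fin d) : J i < ⌈G.L * G.η / d⌉₊ + 1 := by
  have hL := hG.L_pos
  have hη := hG.η_pos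
  have hd : (0 : ℝ) < d := by exact_mod_cast i.pos
  have h := hJ i
  simp only [lower] at h
  cases hk : J i with
  | zero => omega
  | succ k =>
    rw [hk] at h
    simp only [left] at h
    have h1 : 0 < 2 / G.L := by positivity
    have h2 := hG.offset_nonneg i
    have h3 : (k : ℝ) * ((d : ℝ) / (G.L * G.η)) < 1 := by
      have : (k : ℝ) * ((d : ℝ) / (G.L * G.η)) ≤ k * G.period :=
        mul_le_mul_of_nonneg_left (by unfold period; linarith) (Nat.cast_nonneg k)
      linarith
    have h4 : (k : ℝ) < G.L * G.η / d := by
      rw [lt_div_iff₀ hd]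
      rw [← mul_div_assoc, div_lt_one (by positivity)] at h3
      exact h3
    have h5 : (k : ℝ) < ⌈G.L * G.η / d⌉₊ := h4.trans_le (Nat.le_ceil _)
    have h6 : k < ⌈G.L * G.η / d⌉₊ := by exact_mod_cast h5
    omega

lemma exists_index_finset {G : Grid d} (hG : G.Proper) :
    ∃ I : Finset (Fin d → ℕ), (∀ J, J ∈ I ↔ G.IsIndex J) ∧
      I.card ≤ (⌈G.L * G.η / d⌉₊ + 1) ^ d := by
  classical
  refine ⟨{J ∈ Fintype.piFinset fun _ : Fin d => Finset.range (⌈G.L * G.η / d⌉₊ + 1) | G.IsIndex J},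
    fun J => ?_, ?_⟩
  · simp only [Finset.mem_filter, Fintype.mem_piFinset, Finset.mem_range, and_iff_right_iff_imp]
    exact fun hJ i => hJ.lt hG i
  · refine (Finset.card_filter_le _ _).trans (le_of_eq ?_)
    rw [Fintype.card_piFinset_const, Finset.card_range]

lemma offset_le {L η : ℝ} (hL : 0 < L) (hη : 0 < η) (o : Fin d → Fin (maxOffset d η + 1))
    (i : Fin d) : (offsetGrid L η o).offset i ≤ d / (L * η) := by
  have h1 : ((o i : ℕ) : ℝ) ≤ maxOffset d η := by exact_mod_cast Nat.lt_succ_iff.1 (o i).2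
  have h2 : ((maxOffset d η : ℕ) : ℝ) ≤ (d : ℝ) / (2 * η) := Nat.floor_le (by positivity)
  have h3 : (d : ℝ) / (L * η) = d / (2 * η) * (2 / L) := by field_simp
  rw [h3]
  exact mul_le_mul_of_nonneg_right (h1.trans h2) (by positivity)

/-- Both bounds matter: `d / (L * η)` makes the label count independent of `L`, and `1` is needed
for the pool size when one box can exceed the cube. -/
lemma side_le {G : Grid d} (hG : G.Proper) (hoff : ∀ i, G.offset i ≤ d / (G.L * G.η))
    (J : Fin d → ℕ) {x : Cube d} (hx : x ∈ box (G.lower J) (G.upper J)) (i : Fin d) :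
    (x i : ℝ) - G.lower J i ≤ min 1 (d / (G.L * G.η)) := by
  have h := hx i
  refine le_min ?_ ?_
  · have := hG.left_nonneg i (J i)
    simp only [Grid.lower]
    linarith [(x i).2.2]
  · simp only [Grid.lower, Grid.upper] at h ⊢
    cases hk : J i with
    | zero =>
      rw [hk] at h
      simp only [Grid.left, Grid.right] at h ⊢
      have := hoff i
      push_cast at h
      linarith
    | succ k =>
      rw [hk] at h
      simp only [Grid.left, Grid.right] at h ⊢
      push_cast at h
      have : G.period = d / (G.L * G.η) + 2 / G.L := rfl
      linarith

lemma measurable_estimate {L η : ℝ} (hL : 0 < L) (hη : 0 < η) {A : BoxRule d}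
    (hA : IsERMRule L A) (cap : ℕ) :
    Measurable fun ω : Outcome d M N η => ω.estimate L A cap := by
  simp only [estimate_eq]
  refine measurable_from_prod_countable_right fun o => ?_
  have hq := measurable_query (M := M) (offsetGrid_proper hL hη o) hA cap
  refine (Finset.measurable_sum _ fun t _ => ?_).div_const _
  have h1 : Measurable fun p : (Fin M → Cube d × unitInterval) × (Fin N → Cube d × unitInterval) =>
      p.2 t := (measurable_pi_apply t).comp measurable_snd
  have h2 := hq.comp (measurable_fst.prodMk (measurable_fst.comp h1))
  have h3 := (measurable_subtype_coe.comp h2).sub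
    (measurable_subtype_coe.comp (measurable_snd.comp h1))
  exact continuous_abs.measurable.comp h3

variable {D : Measure (Cube d × unitInterval)}

lemma err_nonneg (f : Cube d → unitInterval) : 0 ≤ err D f :=
  integral_nonneg fun _ => abs_nonneg _

lemma optErr_le_err {L : ℝ} {f : Cube d → unitInterval} (hf : f ∈ lipClass d L) :
    optErr D L ≤ err D f :=
  ciInf_le (f := fun g : lipClass d L => err D (g : Cube d → unitInterval))
    ⟨0, by rintro _ ⟨g, rfl⟩; exact err_nonneg _⟩ ⟨f, hf⟩

lemma exists_err_le {L : ℝ} (hL : 0 ≤ L) {γ : ℝ} (hγ : 0 < γ) :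
    ∃ f ∈ lipClass d L, err D f ≤ optErr D L + γ := by
  have : Nonempty (lipClass d L) := ⟨⟨_, one_mem_lipClass hL⟩⟩
  obtain ⟨f, hf⟩ := exists_lt_of_ciInf_lt
    (f := fun g : lipClass d L => err D (g : Cube d → unitInterval))
    (show optErr D L < optErr D L + γ by linarith)
  exact ⟨f, f.2, hf.le⟩

variable [IsProbabilityMeasure D]

instance isProbabilityMeasure_outcomeLaw (M N : ℕ) (η : ℝ) : IsProbabilityMeasure (outcomeLaw M N η D) := by
  unfold outcomeLaw
  infer_instance

/-- The terms come from the test sample (`t`), the near-optimality of the competitor (`γ`), the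
short intervals (`2 * η`), the well-sampled boxes (`7 * δ + β`) and the boxes with short lists. -/
lemma lintegral_estimate_le {L η : ℝ} (hL : 0 < L) (hη : 0 < η) {A : BoxRule d}
    (hA : IsERMRule L A) {K : ℕ} (hK : 0 < K) (hM : 0 < M) (hN : 0 < N) {t γ δ : ℝ} (ht : 0 < t)
    (hNt : 1 ≤ N * t ^ 2) (hγ : 0 < γ) (hδ : 0 < δ) {r q : ℕ} (hr0 : 0 < r)
    (hr : L * min 1 (d / (L * η)) ≤ δ * r) (hq : 1 / δ < q) (hd : 1 ≤ d) {β : ℝ≥0∞}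
    (hβ : ((q ^ (r + 1) ^ d : ℕ) : ℝ≥0∞) * ENNReal.ofReal (Real.exp (-(K * δ ^ 2 / 2))) ≤ β) :
    ∫⁻ ω : Outcome d M N η, ENNReal.ofReal |ω.estimate L A K - optErr D L| ∂outcomeLaw M N η D ≤
      ENNReal.ofReal t + ENNReal.ofReal γ + (ENNReal.ofReal (2 * η) + (ENNReal.ofReal (7 * δ) + β +
        ((⌈L * η / d⌉₊ + 1) ^ d : ℕ) * (K / M))) := by
  obtain ⟨f, hf, hfγ⟩ := exists_err_le (D := D) hL.le hγ
  have hd' : (0 : ℝ) < d := by exact_mod_cast hd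
  have hpoint : ∀ (o : Fin d → Fin (maxOffset d η + 1)) (P : Fin M → Cube d × unitInterval)
      (T : Fin N → Cube d × unitInterval),
      ENNReal.ofReal |Outcome.estimate L A K ((o, P, T) : Outcome d M N η) - optErr D L| ≤
      ENNReal.ofReal |(∑ i, loss (query A (offsetGrid L η o) K P) (T i)) / N -
        err D (query A (offsetGrid L η o) K P)| + (ENNReal.ofReal γ +
        ENNReal.ofReal (err D (query A (offsetGrid L η o) K P) - err D f)) := by
    intro o P T
    rw [estimate_eq]
    have h1 := optErr_le_err (D := D) (query_mem_lipClass (offsetGrid_proper hL hη o) hA K P)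
    set h := query A (offsetGrid L η o) K P
    have h2 : (∑ i, |(h (T i).1 : ℝ) - (T i).2|) = ∑ i, loss h (T i) :=
      Finset.sum_congr rfl fun i _ => abs_sub_comm _ _
    change ENNReal.ofReal |(∑ i, |(h (T i).1 : ℝ) - (T i).2|) / N - optErr D L| ≤ _
    change optErr D L ≤ err D h at h1
    rw [h2]
    have h3 := abs_add_le ((∑ i, loss h (T i)) / N - err D h) (err D h - optErr D L)
    rw [sub_add_sub_cancel, abs_of_nonneg (sub_nonneg.2 h1)] at h3
    refine (ENNReal.ofReal_le_ofReal h3).trans (ENNReal.ofReal_add_le.trans ?_)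
    refine add_le_add_right ((ENNReal.ofReal_le_ofReal ?_).trans ENNReal.ofReal_add_le) _
    linarith
  set c := ENNReal.ofReal (7 * δ) + β + ((⌈L * η / d⌉₊ + 1) ^ d : ℕ) * ((K : ℝ≥0∞) / M) with hc
  have hgrid : ∀ o : Fin d → Fin (maxOffset d η + 1),
      ∫⁻ P : Fin M → Cube d × unitInterval,
        ENNReal.ofReal (err D (query A (offsetGrid L η o) K P) - err D f)
          ∂Measure.pi (fun _ => D) ≤ D (outside (offsetGrid L η o)) + c := fun o => by
    have hG := offsetGrid_proper hL hη o
    obtain ⟨I, hI, hcard⟩ := exists_index_finset hG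
    refine (lintegral_err_query_sub_le (κ := (Fin d → Fin (r + 1)) → Fin q) hG hA hf hK hM hδ.le
      (β := β) ?_ (fun J _ => ?_) I hI).trans ?_
    · simpa using hβ
    · exact exists_net hL.le (by positivity) (fun x hx i => side_le hG (offset_le hL hη o) J hx i)
        hδ hr0 hr hq
    · have hcard' : (I.card : ℝ≥0∞) ≤ (((⌈L * η / d⌉₊ + 1) ^ d : ℕ) : ℝ≥0∞) := by
        exact_mod_cast hcard
      rw [hc]
      gcongr
  unfold outcomeLaw
  refine (lintegral_prod_le _).trans ?_
  calc _ ≤ ∫⁻ o, ((ENNReal.ofReal t + ENNReal.ofReal γ + c) + D (outside (offsetGrid L η o)))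
        ∂(PMF.uniformOfFintype (Fin d → Fin (maxOffset d η + 1))).toMeasure := by
        refine lintegral_mono fun o => (lintegral_prod_le _).trans ?_
        calc _ ≤ ∫⁻ P : Fin M → Cube d × unitInterval,
              (ENNReal.ofReal t + ENNReal.ofReal γ +
                ENNReal.ofReal (err D (query A (offsetGrid L η o) K P) - err D f))
                ∂Measure.pi (fun _ => D) := by
              refine lintegral_mono fun P => (lintegral_mono fun T => hpoint o P T).trans ?_
              rw [lintegral_add_right _ measurable_const, lintegral_const, measure_univ, mul_one,
                ← add_assoc]
              have hm := lipClass_measurable hL.le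
                (query_mem_lipClass (offsetGrid_proper hL hη o) hA K P)
              gcongr
              exact lintegral_test_le hm hN ht hNt
          _ ≤ ENNReal.ofReal t + ENNReal.ofReal γ + (D (outside (offsetGrid L η o)) + c) := by
              rw [lintegral_add_left measurable_const, lintegral_const, measure_univ, mul_one]
              exact add_le_add_right (hgrid o) _
          _ = _ := by ring
    _ ≤ (ENNReal.ofReal t + ENNReal.ofReal γ + c) + ENNReal.ofReal (2 * η) := by
        rw [lintegral_add_left measurable_const, lintegral_const, measure_univ, mul_one]
        exact add_le_add_right (lintegral_outside_le hL hη D) _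
    _ = _ := by ring

lemma half_le_measure_of_lintegral_le {L η ε : ℝ} (hL : 0 < L) (hη : 0 < η) (hε : 0 < ε)
    {A : BoxRule d} (hA : IsERMRule L A) {K : ℕ}
    (h : ∫⁻ ω : Outcome d M N η, ENNReal.ofReal |ω.estimate L A K - optErr D L|
      ∂outcomeLaw M N η D ≤ ENNReal.ofReal (ε / 2)) :
    (1 / 2 : ℝ≥0∞) ≤ outcomeLaw M N η D
      {ω | |Outcome.estimate L A K ω - optErr D L| ≤ ε} := by
  have hm : Measurable fun ω : Outcome d M N η => |ω.estimate L A K - optErr D L| :=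
    continuous_abs.measurable.comp ((measurable_estimate hL hη hA K).sub_const _)
  have h1 := meas_ge_le_lintegral_div (μ := outcomeLaw M N η D) hm.ennreal_ofReal.aemeasurable
    (ε := ENNReal.ofReal ε) (by simpa using hε) ENNReal.ofReal_ne_top
  have h2 : outcomeLaw M N η D {ω | |Outcome.estimate L A K ω - optErr D L| ≤ ε}ᶜ ≤ 1 / 2 := by
    refine (measure_mono fun ω hω => ?_).trans (h1.trans ?_)
    · simp only [Set.mem_compl_iff, Set.mem_ofPred_eq, not_le] at hω
      exact ENNReal.ofReal_le_ofReal hω.le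
    · refine ENNReal.div_le_of_le_mul (h.trans (le_of_eq ?_))
      rw [ENNReal.ofReal_div_of_pos two_pos, ENNReal.ofReal_ofNat, one_div, ENNReal.div_eq_inv_mul]
  have hS : MeasurableSet {ω : Outcome d M N η |
      |Outcome.estimate L A K ω - optErr D L| ≤ ε} := measurableSet_le hm measurable_const
  have h3 := prob_add_prob_compl (μ := outcomeLaw M N η D) hS
  by_contra! hlt
  have h4 := ENNReal.add_lt_add_of_lt_of_le (ne_top_of_le_ne_top (by simp) h2) hlt h2
  rw [h3, ENNReal.add_halves] at h4
  exact lt_irrefl _ h4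

end LocalLip

/-! ### Choice of the sizes and numerical bounds. -/

namespace LocalLip

open scoped ENNReal

lemma mul_pow_le_mul_pow {A X : ℝ} (hA : 1 ≤ A) (hX : 0 ≤ X) {d : ℕ} (hd : 1 ≤ d) :
    A * X ^ d ≤ (A * X) ^ d := by
  rw [mul_pow]
  exact mul_le_mul_of_nonneg_right (le_self_pow₀ hA (by omega)) (by positivity)

/-- The pool size needed per box for the union bound over the net. -/
noncomputable def capSize (δ : ℝ) (R q : ℕ) : ℕ :=
  ⌈2 * (R * Real.log q + Real.log (1 / δ)) / δ ^ 2⌉₊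

lemma card_mul_exp_le {δ : ℝ} (hδ : 0 < δ) {R q : ℕ} (hq : 0 < q) :
    ((q ^ R : ℕ) : ℝ≥0∞) * ENNReal.ofReal (Real.exp (-(capSize δ R q * δ ^ 2 / 2))) ≤
      ENNReal.ofReal δ := by
  have hq' : (0 : ℝ) < q := by exact_mod_cast hq
  rw [← ENNReal.ofReal_natCast, ← ENNReal.ofReal_mul (Nat.cast_nonneg _)]
  refine ENNReal.ofReal_le_ofReal ?_
  have h1 : 2 * (R * Real.log q + Real.log (1 / δ)) / δ ^ 2 ≤ capSize δ R q := Nat.le_ceil _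
  rw [div_le_iff₀ (by positivity)] at h1
  have h2 : ((q ^ R : ℕ) : ℝ) = Real.exp (R * Real.log q) := by
    rw [Real.exp_nat_mul, Real.exp_log hq']
    push_cast
    rfl
  rw [h2, ← Real.exp_add]
  calc _ ≤ Real.exp (-Real.log (1 / δ)) := Real.exp_le_exp.2 (by linarith)
    _ = δ := by rw [one_div, Real.log_inv, neg_neg, Real.exp_log hδ]

/-- Since `ε` stays away from `1`, `log (1 / ε)` is bounded below and absorbs additive constants. -/
lemma log_div_le {ε e b : ℝ} (hε : 0 < ε) (hεe : ε ≤ e) (he : e < 1) (hb : 0 < b) :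
    Real.log (b / ε) ≤ (1 + b / Real.log (1 / e)) * Real.log (1 / ε) := by
  have he0 : 0 < e := hε.trans_le hεe
  have h1 : 0 < Real.log (1 / e) := Real.log_pos (by rw [lt_div_iff₀ he0]; linarith)
  have h2 : Real.log (1 / e) ≤ Real.log (1 / ε) :=
    Real.log_le_log (by positivity) (one_div_le_one_div_of_le hε hεe)
  have h3 : Real.log (b / ε) = Real.log b + Real.log (1 / ε) := by
    rw [← Real.log_mul hb.ne' (by positivity), mul_one_div]
  have h4 : b ≤ b / Real.log (1 / e) * Real.log (1 / ε) := by
    rw [div_mul_eq_mul_div, le_div_iff₀ h1]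
    exact mul_le_mul_of_nonneg_left h2 hb.le
  have h5 := Real.log_le_sub_one_of_pos hb
  linarith

lemma capSize_le {ε a : ℝ} (hε : 0 < ε) (hε1 : ε < 1) {R q : ℕ} (hR : 1 ≤ R)
    (hq : Real.log q ≤ a) (hδ : Real.log (1 / (ε / 256)) ≤ a) (ha : 1 ≤ a) :
    (capSize (ε / 256) R q : ℝ) ≤ 262145 * (a * R / ε ^ 2) := by
  have hR' : (1 : ℝ) ≤ R := by exact_mod_cast hR
  have hlogq : 0 ≤ Real.log q := Real.log_natCast_nonneg q
  have hlogδ : 0 ≤ Real.log (1 / (ε / 256)) := Real.log_nonneg (by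
    rw [le_div_iff₀ (by positivity)]
    linarith)
  have h1 := (Nat.ceil_lt_add_one
    (a := 2 * (R * Real.log q + Real.log (1 / (ε / 256))) / (ε / 256) ^ 2) (by positivity)).le
  have h2 : R * Real.log q + Real.log (1 / (ε / 256)) ≤ 2 * (a * R) := by
    nlinarith
  have h3 : 2 * (R * Real.log q + Real.log (1 / (ε / 256))) / (ε / 256) ^ 2 =
      131072 * ((R * Real.log q + Real.log (1 / (ε / 256))) / ε ^ 2) := by
    field_simp
    ring
  have h4 : (R * Real.log q + Real.log (1 / (ε / 256))) / ε ^ 2 ≤ 2 * (a * R / ε ^ 2) := by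
    rw [← mul_div_assoc]
    exact div_le_div_of_nonneg_right h2 (by positivity)
  have h5 : 1 ≤ a * R / ε ^ 2 := by
    rw [le_div_iff₀ (by positivity)]
    nlinarith
  rw [h3] at h1
  unfold capSize
  rw [h3]
  linarith

/-- The number of grid points per axis in a box, minus one. -/
noncomputable def cellCount (d : ℕ) (L ε : ℝ) : ℕ :=
  ⌈L * min 1 (d / (L * (1 / 32 * ε))) / (ε / 256)⌉₊

/-- The bound for the number of long intervals per axis, minus one. -/
noncomputable def boxCount (d : ℕ) (L ε : ℝ) : ℕ := ⌈L * (1 / 32 * ε) / d⌉₊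

section

variable {d : ℕ} {L ε : ℝ}

lemma cellCount_pos (hd : 1 ≤ d) (hε : 0 < ε) (hL : 0 < L) : 0 < cellCount d L ε := by
  have hd' : (0 : ℝ) < d := by exact_mod_cast hd
  exact Nat.ceil_pos.2 (by positivity)

lemma le_cellCount (hε : 0 < ε) :
    L * min 1 (d / (L * (1 / 32 * ε))) ≤ ε / 256 * cellCount d L ε := by
  have h := Nat.le_ceil (L * min 1 (d / (L * (1 / 32 * ε))) / (ε / 256))
  rw [div_le_iff₀ (by positivity)] at h
  rwa [mul_comm (ε / 256)]

lemma cellCount_le (hd : 1 ≤ d) (hε : 0 < ε) (hL : 0 < L) :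
    (cellCount d L ε : ℝ) ≤ L * min 1 (d / (L * (1 / 32 * ε))) / (ε / 256) + 1 := by
  have hd' : (0 : ℝ) < d := by exact_mod_cast hd
  exact (Nat.ceil_lt_add_one (by positivity)).le

lemma cellCount_add_one_le (hd : 1 ≤ d) (hε : 0 < ε) (hε1 : ε < 1) (hL : 0 < L) :
    (cellCount d L ε : ℝ) + 1 ≤ 8194 * (d / ε ^ 2) := by
  have hd' : (1 : ℝ) ≤ d := by exact_mod_cast hd
  have h1 := cellCount_le hd hε hL
  have h2 : L * min 1 (d / (L * (1 / 32 * ε))) / (ε / 256) ≤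
      L * (d / (L * (1 / 32 * ε))) / (ε / 256) := by
    gcongr
    exact min_le_right _ _
  have h3 : L * (d / (L * (1 / 32 * ε))) / (ε / 256) = 8192 * (d / ε ^ 2) := by
    field_simp
    norm_num
  have h4 : 1 ≤ d / ε ^ 2 := by
    rw [le_div_iff₀ (by positivity)]
    nlinarith
  linarith

/-- Long boxes are few and short boxes need few grid points: in the product the side length cancels.
For `y` alone the bound `1` on the side is used, for `x * y` the bound `d / (L * η)`. -/
lemma boxCount_mul_cellCount_le (hd : 1 ≤ d) (hε : 0 < ε) (hε1 : ε < 1) (hεL : ε ≤ L) :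
    ((boxCount d L ε : ℝ) + 1) * (cellCount d L ε + 1) ≤ 8194 * (L / ε) := by
  have hL : 0 < L := hε.trans_le hεL
  have hd' : (1 : ℝ) ≤ d := by exact_mod_cast hd
  have h1 := cellCount_le hd hε hL
  have h2 : (boxCount d L ε : ℝ) ≤ L * (1 / 32 * ε) / d + 1 :=
    (Nat.ceil_lt_add_one (by positivity)).le
  set x := L * (1 / 32 * ε) / d with hx
  set y := L * min 1 (d / (L * (1 / 32 * ε))) / (ε / 256) with hy
  have hx0 : 0 ≤ x := by positivity
  have hy0 : 0 ≤ y := by positivity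
  have hu : 1 ≤ L / ε := by rwa [one_le_div hε]
  have hxle : x ≤ L / ε := by
    rw [hx, div_le_div_iff₀ (by positivity) hε]
    have : L * (1 / 32 * ε) * ε ≤ L * 1 := by
      rw [mul_assoc]
      exact mul_le_mul_of_nonneg_left (by nlinarith) hL.le
    nlinarith
  have hyle : y ≤ 256 * (L / ε) := by
    have h3 : y ≤ L * 1 / (ε / 256) := by
      rw [hy]
      gcongr
      exact min_le_left _ _
    have h4 : L * 1 / (ε / 256) = 256 * (L / ε) := by field_simp
    linarith
  have hxy : x * y ≤ 256 * (L / ε) := by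
    have h3 : y ≤ L * (d / (L * (1 / 32 * ε))) / (ε / 256) := by
      rw [hy]
      gcongr
      exact min_le_right _ _
    have h4 : x * (L * (d / (L * (1 / 32 * ε))) / (ε / 256)) = 256 * (L / ε) := by
      rw [hx]
      field_simp
    exact (mul_le_mul_of_nonneg_left h3 hx0).trans h4.le
  calc ((boxCount d L ε : ℝ) + 1) * (cellCount d L ε + 1) ≤ (x + 2) * (y + 2) := by
        exact mul_le_mul (by linarith) (by linarith) (by positivity) (by linarith)
    _ = x * y + 2 * x + 2 * y + 4 := by ring
    _ ≤ 8194 * (L / ε) := by linarith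

end

lemma card_mul_div_ceil_le {T K : ℕ} {ε : ℝ} (hε : 0 < ε) (hT : 0 < T) (hK : 0 < K) :
    (T : ℝ≥0∞) * (K / (⌈32 * (T * K) / ε⌉₊ : ℕ)) ≤ ENNReal.ofReal (ε / 32) := by
  have hT' : (0 : ℝ) < T := by exact_mod_cast hT
  have hK' : (0 : ℝ) < K := by exact_mod_cast hK
  have h1 : 32 * (T * K) / ε ≤ (⌈32 * (T * K) / ε⌉₊ : ℕ) := Nat.le_ceil _
  rw [← mul_div_assoc]
  refine ENNReal.div_le_of_le_mul ?_
  rw [← ENNReal.ofReal_natCast T, ← ENNReal.ofReal_natCast K, ← ENNReal.ofReal_natCast (⌈_⌉₊),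
    ← ENNReal.ofReal_mul hT'.le, ← ENNReal.ofReal_mul (by positivity)]
  refine ENNReal.ofReal_le_ofReal ?_
  rw [div_le_iff₀ hε] at h1
  linarith

lemma sum_ofReal_le {ε : ℝ} (hε : 0 < ε) {x : ℝ≥0∞} (hx : x ≤ ENNReal.ofReal (ε / 32)) :
    ENNReal.ofReal (ε / 4) + ENNReal.ofReal (ε / 32) + (ENNReal.ofReal (2 * (1 / 32 * ε)) +
      (ENNReal.ofReal (7 * (ε / 256)) + ENNReal.ofReal (ε / 256) + x)) ≤
      ENNReal.ofReal (ε / 2) := by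
  refine (add_le_add_right (add_le_add_right (add_le_add_right hx _) _) _).trans ?_
  rw [← ENNReal.ofReal_add (by positivity) (by positivity),
    ← ENNReal.ofReal_add (by positivity) (by positivity),
    ← ENNReal.ofReal_add (by positivity) (by positivity),
    ← ENNReal.ofReal_add (by positivity) (by positivity),
    ← ENNReal.ofReal_add (by positivity) (by positivity)]
  exact ENNReal.ofReal_le_ofReal (by linarith)

end LocalLip

open LocalLip in
theorem mainTheorem4 (ε₀ : ℝ) (hε₀ : ε₀ < 1) :
    ∃ c C : ℝ, 0 < c ∧ c ≤ 1 ∧ 0 < C ∧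
      ∀ (d : ℕ) (L ε : ℝ), 1 ≤ d → 0 < ε → ε ≤ ε₀ → ε ≤ L →
        ∃ M N cap : ℕ,
          (M + N : ℝ) ≤ 1 / ε ^ 3 * (C * (L / ε)) ^ d * Real.log (1 / ε) ∧
          (N : ℝ) ≤ C / ε ^ 2 ∧
          (∃ A : LocalLip.BoxRule d, LocalLip.IsERMRule L A) ∧
          ∀ A : LocalLip.BoxRule d, LocalLip.IsERMRule L A →
            (∀ ω : LocalLip.Outcome d M N (c * ε),
              (LocalLip.Outcome.numLabels L A cap ω : ℝ) ≤
                1 / ε ^ 4 * (C * (d / ε ^ 2)) ^ d * Real.log (1 / ε)) ∧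
            ∀ (D : MeasureTheory.Measure (LocalLip.Cube d × unitInterval))
              [MeasureTheory.IsProbabilityMeasure D],
              (1 / 2 : ENNReal) ≤ LocalLip.outcomeLaw M N (c * ε) D
                {ω | |LocalLip.Outcome.estimate L A cap ω - LocalLip.optErr D L| ≤ ε} := by
  -- The maximum keeps `e` positive when `ε₀` is not.
  set e := max ε₀ (1 / 2) with he
  have he1 : e < 1 := max_lt hε₀ (by norm_num)
  have he0 : 0 < e := lt_max_of_lt_right (by norm_num)
  have hloge : 0 < Real.log (1 / e) := Real.log_pos (by rw [lt_div_iff₀ he0]; linarith)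
  -- The factor of `log_div_le` for `b = 257`, because `q ≤ 256 / ε + 1 ≤ 257 / ε`.
  set a := 1 + 257 / Real.log (1 / e) with ha
  have ha1 : 1 ≤ a := by
    have : 0 < 257 / Real.log (1 / e) := by positivity
    linarith
  -- Anything from `33 * 262145 + 17` on suffices for pool plus test points, where `33` is `32` plus
  -- one for rounding up; the labels need only `17 * 262146`.
  set B := 8650835 * a with hB
  have hB1 : 1 ≤ B := by linarith
  refine ⟨1 / 32, B * 8194, by norm_num, by norm_num, by linarith, ?_⟩
  intro d L ε hd hε hεε₀ hεL
  have hεe : ε ≤ e := hεε₀.trans (le_max_left _ _)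
  have hε1 : ε < 1 := hεe.trans_lt he1
  have hL : 0 < L := hε.trans_le hεL
  have hd' : (1 : ℝ) ≤ d := by exact_mod_cast hd
  set l := Real.log (1 / ε) with hl
  have hal : 1 ≤ a * l := by
    have h1 : Real.log (1 / e) ≤ l :=
      Real.log_le_log (by positivity) (one_div_le_one_div_of_le hε hεe)
    have h2 : 257 ≤ 257 / Real.log (1 / e) * l := by
      rw [div_mul_eq_mul_div, le_div_iff₀ hloge]
      linarith
    rw [ha]
    linarith
  have hl0 : 0 < l := by
    by_contra! h
    nlinarith
  set R := (cellCount d L ε + 1) ^ d with hR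
  set T := (boxCount d L ε + 1) ^ d with hT
  set q := ⌊1 / (ε / 256)⌋₊ + 1 with hq
  set K := capSize (ε / 256) R q with hK
  have hR1 : 1 ≤ R := Nat.one_le_pow _ _ (by omega)
  have hT1 : 1 ≤ T := Nat.one_le_pow _ _ (by omega)
  have hR1' : (1 : ℝ) ≤ R := by exact_mod_cast hR1
  have hT1' : (1 : ℝ) ≤ T := by exact_mod_cast hT1
  have hdiv : 1 / (ε / 256) = 256 / ε := by field_simp
  have hlogδ : Real.log (1 / (ε / 256)) ≤ a * l := by
    rw [hdiv]
    refine (Real.log_le_log (by positivity) ?_).trans (log_div_le hε hεe he1 (b := 257) (by norm_num))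
    exact div_le_div_of_nonneg_right (by norm_num) hε.le
  have hlogq : Real.log q ≤ a * l := by
    refine (Real.log_le_log (by positivity) ?_).trans (log_div_le hε hεe he1 (b := 257) (by norm_num))
    have h1 := Nat.floor_le (a := 1 / (ε / 256)) (by positivity)
    have h2 : 1 ≤ 1 / ε := by
      rw [le_div_iff₀ hε]
      linarith
    have h3 : 257 / ε = 256 / ε + 1 / ε := by ring
    rw [hq, h3]
    push_cast
    linarith
  have hKpos : 0 < K := by
    refine Nat.ceil_pos.2 ?_
    have h1 : 0 < Real.log (1 / (ε / 256)) := Real.log_pos (by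
      rw [lt_div_iff₀ (by positivity)]
      linarith)
    have h2 := Real.log_natCast_nonneg q
    positivity
  have hKpos' : (1 : ℝ) ≤ K := by exact_mod_cast hKpos
  have hKle : (K : ℝ) ≤ 262145 * (a * l * R / ε ^ 2) := capSize_le hε hε1 hR1 hlogq hlogδ hal
  have hNle : (⌈16 / ε ^ 2⌉₊ : ℝ) ≤ 17 / ε ^ 2 := by
    have h1 := (Nat.ceil_lt_add_one (a := 16 / ε ^ 2) (by positivity)).le
    have h2 : 1 ≤ 1 / ε ^ 2 := by
      rw [le_div_iff₀ (by positivity)]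
      nlinarith
    have h3 : 17 / ε ^ 2 = 16 / ε ^ 2 + 1 / ε ^ 2 := by ring
    linarith
  have hNpos : 0 < ⌈16 / ε ^ 2⌉₊ := Nat.ceil_pos.2 (by positivity)
  have hMpos : 0 < ⌈32 * (T * K) / ε⌉₊ := Nat.ceil_pos.2 (by positivity)
  -- `M` makes the cost `T * K / M` of short lists at most `ε / 32`, and `N` satisfies `1 ≤ N * t ^
  -- 2` for `t = ε / 4`.
  refine ⟨⌈32 * (T * K) / ε⌉₊, ⌈16 / ε ^ 2⌉₊, K, ?_, ?_,
    ⟨mcShaneRule hL.le, isERMRule_mcShaneRule hL⟩, fun A hA => ⟨fun ω => ?_, fun D _ => ?_⟩⟩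
  · have hTR : (T : ℝ) * R ≤ (8194 * (L / ε)) ^ d := by
      rw [hT, hR]
      push_cast
      rw [← mul_pow]
      exact pow_le_pow_left₀
        (by positivity : (0 : ℝ) ≤ ((boxCount d L ε : ℝ) + 1) * (cellCount d L ε + 1)) (boxCount_mul_cellCount_le hd hε hε1 hεL) d
    have h1 := (Nat.ceil_lt_add_one (a := 32 * (T * K) / ε) (by positivity)).le
    have h2 : 1 ≤ T * K / ε := by
      rw [le_div_iff₀ hε]
      nlinarith
    have h3 : 32 * (T * K) / ε = 32 * (T * K / ε) := by ring
    have h4 : T * K / ε ≤ 262145 * (a * l * (T * R) / ε ^ 3) := by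
      rw [div_le_iff₀ hε]
      refine (mul_le_mul_of_nonneg_left hKle (by positivity)).trans (le_of_eq ?_)
      field_simp
    have h5 : 17 / ε ^ 2 ≤ 17 * (a * l * (T * R) / ε ^ 3) := by
      rw [← mul_div_assoc, div_le_div_iff₀ (by positivity) (by positivity)]
      have h6 : 1 ≤ a * l * (T * R) :=
        one_le_mul_of_one_le_of_one_le hal (one_le_mul_of_one_le_of_one_le hT1' hR1')
      have h7 : ε ^ 3 ≤ ε ^ 2 := pow_le_pow_of_le_one hε.le hε1.le (by norm_num)
      have h8 : ε ^ 2 ≤ a * l * (T * R) * ε ^ 2 := le_mul_of_one_le_left (by positivity) h6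
      linarith
    calc ((⌈32 * (T * K) / ε⌉₊ : ℕ) : ℝ) + (⌈16 / ε ^ 2⌉₊ : ℕ)
        ≤ 8650835 * (a * l * (T * R) / ε ^ 3) := by
          have : 0 ≤ a * l * (T * R) / ε ^ 3 := by positivity
          linarith
      _ = 1 / ε ^ 3 * (B * (T * R)) * l := by rw [hB]; ring
      _ ≤ 1 / ε ^ 3 * (B * (8194 * (L / ε)) ^ d) * l := by gcongr
      _ ≤ 1 / ε ^ 3 * (B * 8194 * (L / ε)) ^ d * l := by
          gcongr
          rw [mul_assoc B 8194]
          refine mul_pow_le_mul_pow hB1 ?_ hd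
          positivity
  · refine hNle.trans (div_le_div_of_nonneg_right ?_ (by positivity))
    linarith
  · have hRle : (R : ℝ) ≤ (8194 * (d / ε ^ 2)) ^ d := by
      rw [hR]
      push_cast
      exact pow_le_pow_left₀ (by positivity : (0 : ℝ) ≤ (cellCount d L ε : ℝ) + 1) (cellCount_add_one_le hd hε hε1 hL) d
    have h1 : ((ω.numLabels L A K : ℕ) : ℝ) ≤ (⌈16 / ε ^ 2⌉₊ : ℕ) * ((K : ℝ) + 1) := by
      exact_mod_cast numLabels_le L A K ω
    have h2 : 1 ≤ a * l * R / ε ^ 2 := by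
      rw [le_div_iff₀ (by positivity)]
      nlinarith
    calc ((ω.numLabels L A K : ℕ) : ℝ) ≤ (⌈16 / ε ^ 2⌉₊ : ℕ) * ((K : ℝ) + 1) := h1
      _ ≤ 17 / ε ^ 2 * (262146 * (a * l * R / ε ^ 2)) := by
          gcongr
          linarith
      _ = 4456482 * (a * l * R / ε ^ 4) := by
          field_simp
          norm_num
      _ ≤ 8650835 * (a * l * R / ε ^ 4) := by
          gcongr
          norm_num
      _ = 1 / ε ^ 4 * (B * R) * l := by rw [hB]; ring
      _ ≤ 1 / ε ^ 4 * (B * (8194 * (d / ε ^ 2)) ^ d) * l := by gcongr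
      _ ≤ 1 / ε ^ 4 * (B * 8194 * (d / ε ^ 2)) ^ d * l := by
          gcongr
          rw [mul_assoc B 8194]
          refine mul_pow_le_mul_pow hB1 ?_ hd
          positivity
  · have hη : 0 < 1 / 32 * ε := by positivity
    refine half_le_measure_of_lintegral_le hL hη hε hA ?_
    refine (lintegral_estimate_le (t := ε / 4) (γ := ε / 32) (δ := ε / 256)
      (r := cellCount d L ε) (q := q) (β := ENNReal.ofReal (ε / 256)) hL hη hA hKpos hMpos hNpos
      (by positivity) ?_ (by positivity) (by positivity) (cellCount_pos hd hε hL)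
      (le_cellCount hε) ?_ hd ?_).trans ?_
    · have h1 : 16 / ε ^ 2 ≤ (⌈16 / ε ^ 2⌉₊ : ℕ) := Nat.le_ceil _
      rw [div_le_iff₀ (by positivity)] at h1
      linarith
    · rw [hq]
      push_cast
      exact Nat.lt_floor_add_one _
    · exact card_mul_exp_le (by positivity) (Nat.succ_pos _)
    · exact sum_ofReal_le hε (card_mul_div_ceil_le hε hT1 hKpos)
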